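/- Setting. Consider an episodic two-player zero-sum Markov game with a state space $\mathcal S$ of volume at most $1$, finite action sets $\mathcal A,\mathcal B$, horizon $H\ge 1$, rewards $r_h:\mathcal S\times\mathcal A\times\mathcal B\to[-1,1]$, fixed initial state $s_1$, and transition densities $\mathbb P_h(s'\mid z)$, $z=(s,a,b)$, $h\in[H]$. Assume that the game has low rank $d$: $\mathbb P_h(s'\mid z)=\psi_h^*(s')^\top\phi_h^*(z)$ with $\|\phi_h^*(z)\|_2\le 1$ and $\|\psi_h^*(s')\|_2\le\sqrt d$ for all $h,z,s'$. Let $\mathcal P_{\mathcal S}^-$ be a probability density on $\mathcal S$ with $\inf_s\mathcal P_{\mathcal S}^-(s)\ge C_{\mathcal S}^->0$. Let $\Psi$ and $\Phi$ be finite classes of maps $\mathcal S\to\mathbb R^d$ and $\mathcal S\times\mathcal A\times\mathcal B\to\mathbb R^d$ with $\|\psi(s)\|_2\le\sqrt d/C_{\mathcal S}^-$, $\|\phi(z)\|_2\le 1$ and $\psi(s')^\top\phi(z)\ge 0$; let $\mathcal F=\{\psi(\cdot)^\top\phi(\cdot):\psi\in\Psi,\phi\in\Phi\}$, put $|\mathcal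 F|:=|\Psi|\,|\Phi|$, and assume $\mathbb P_h(s'\mid z)/\mathcal P_{\mathcal S}^-(s')\in\mathcal F$ for every $h\in[H]$. For a joint policy $\sigma$ let $d_h^\sigma$ be the law of the state at step $h$, let $\tilde d_h^\sigma$ be the law of $(s,a,b)$ with $s\sim d_h^\sigma$ and $(a,b)$ uniform on $\mathcal A\times\mathcal B$, and, for $h\ge 2$, let $\breve d_h^\sigma$ be the law of $(s,a,b)$ with $z'\sim\tilde d_{h-1}^\sigma$, $s\sim\mathbb P_{h-1}(\cdot\mid z')$ and $(a,b)$ uniform. Algorithm (Contrastive ULCB, with parameters $\lambda_k,\gamma_k,\iota_k$). Start with the uniform joint policy $\sigma^0$ and empty data sets. Round $k=1,2,\dots$ is as follows. (1) Independently over $h\in[H]$ and with fresh randomness given the past, draw $\tilde z_h^k\sim\tilde d_h^{\sigma^{k-1}}$, $\tilde s_{h+1}^k\sim\mathbb P_h(\cdot\mid\tilde z_h^k)$ and a label $y_h^k\sim\mathrm{Ber}(1/2)$; add to $\mathcal D_h$ the point $(\tilde z_h^k,\tilde s_{h+1}^k,1)$ if $y_h^k=1$, and $(\tilde z_h^k,s^-,0)$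 with $s^-\sim\mathcal P_{\mathcal S}^-$ if $y_h^k=0$. For $h<H$ draw moreover uniform actions $(\breve a,\breve b)$, put $\breve z=(\tilde s_{h+1}^k,\breve a,\breve b)$, draw $\breve s\sim\mathbb P_{h+1}(\cdot\mid\breve z)$, and add to $\mathcal D_{h+1}$ the point $(\breve z,\breve s,1)$ if $y_h^k=1$, and $(\breve z,\breve s^-,0)$ with $\breve s^-\sim\mathcal P_{\mathcal S}^-$ if $y_h^k=0$. This gives $\mathcal D_h^k$. (2) For $h=H,\dots,1$ let $(\tilde\psi_h^k,\tilde\phi_h^k)$ minimize over $\Psi\times\Phi$ the average over $(z,s',y)\in\mathcal D_h^k$ of $y\log(1+1/\psi(s')^\top\phi(z))+(1-y)\log(1+\psi(s')^\top\phi(z))$ (where $\log(1+1/0)=\infty$). Put $\hat\psi_h^k=\mathcal P_{\mathcal S}^-\tilde\psi_h^k$, $\hat\phi_h^k(z)=\tilde\phi_h^k(z)\big/\int\mathcal P_{\mathcal S}^-(s')\tilde\phi_h^k(z)^\top\tilde\psi_h^k(s')\,\mathrm ds'$ (with $\hat\phi_h^k(z)=0$ if the integral is $0$) and $\hat{\mathbb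 P}_h^k(s'\mid z)=\hat\psi_h^k(s')^\top\hat\phi_h^k(z)$. With $\hat\Sigma_h^k=\frac1k\sum_{\tau=1}^k\hat\phi_h^k(\tilde z_h^\tau)\hat\phi_h^k(\tilde z_h^\tau)^\top+\lambda_kI$ and $\beta_h^k=\min\{\gamma_k\|\hat\phi_h^k\|_{(\hat\Sigma_h^k)^{-1}},2H\}$, put $\overline Q_h^k=r_h+\hat{\mathbb P}_h^k\overline V_{h+1}^k+\beta_h^k$ and $\underline Q_h^k=r_h+\hat{\mathbb P}_h^k\underline V_{h+1}^k-\beta_h^k$ (with $\overline V_{H+1}^k=\underline V_{H+1}^k=0$), let $\sigma_h^k(\cdot,\cdot\mid s)$ be an $\iota_k$-coarse correlated equilibrium of $(\overline Q_h^k(s,\cdot,\cdot),\underline Q_h^k(s,\cdot,\cdot))$, that is, a distribution $\mu$ on $\mathcal A\times\mathcal B$ with marginals $\mu_1,\mu_2$ such that $\mathbb E_\mu\overline Q_h^k(s,a,b)\ge\mathbb E_{b\sim\mu_2}\overline Q_h^k(s,a',b)-\iota_k$ for all $a'$ and $\mathbb E_\mu\underline Q_h^k(s,a,b)\le\mathbb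 E_{a\sim\mu_1}\underline Q_h^k(s,a,b')+\iota_k$ for all $b'$; finally let $\overline V_h^k(s),\underline V_h^k(s)$ be the means of $\overline Q_h^k(s,\cdot,\cdot),\underline Q_h^k(s,\cdot,\cdot)$ under $\sigma_h^k(\cdot,\cdot\mid s)$. Lemma. Put $\tilde\rho_h^k=\frac1k\sum_{k'=0}^{k-1}\tilde d_h^{\sigma^{k'}}$, $\breve\rho_h^k=\frac1k\sum_{k'=0}^{k-1}\breve d_h^{\sigma^{k'}}$, and $$\zeta_h^k=\mathbb E_{z\sim\tilde\rho_h^k}\big[\|\mathbb P_h(\cdot\mid z)-\hat{\mathbb P}_h^k(\cdot\mid z)\|_1^2\big],\qquad \xi_h^k=\mathbb E_{z\sim\breve\rho_h^k}\big[\|\mathbb P_h(\cdot\mid z)-\hat{\mathbb P}_h^k(\cdot\mid z)\|_1^2\big].$$ Let $\delta>0$ and $k\ge 1$. After $k$ rounds of Contrastive ULCB, with probability at least $1-2\delta$, $$\zeta_h^k\le\frac{32d}{(C_{\mathcal S}^-)^2}\cdot\frac{\log(2kH|\mathcal F|/\delta)}{k}\ \text{ for all } 1\le h\le H,\qquad \xi_h^k\le\frac{32d}{(C_{\mathcal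 S}^-)^2}\cdot\frac{\log(2kH|\mathcal F|/\delta)}{k}\ \text{ for all } 2\le h\le H.$$ -/

import Mathlib

open MeasureTheory
open scoped ENNReal

noncomputable section

/-- Feature space: `ℝ^d` with the Euclidean norm. -/
abbrev Feat (d : ℕ) : Type := EuclideanSpace ℝ (Fin d)

/-- A (nonstationary, Markov) joint policy: `σ h s (a, b)` is the probability of playing `(a, b)` in
state `s` at step `h`. -/
abbrev JointPolicy (S A B : Type*) : Type _ := ℕ → S → A × B → ℝ

/-- An episodic zero-sum two-player Markov game with transition densities `P h z s'` with respect to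
a volume measure on the state space. Steps are numbered `0, …, H - 1`. -/
structure MarkovGame (S A B : Type*) [MeasurableSpace S] [MeasurableSpace A]
    [MeasurableSpace B] where
  /-- The length of an episode. -/
  H : ℕ
  /-- The volume on the state space. -/
  vol : Measure S
  /-- The fixed initial state. -/
  s₁ : S
  /-- The reward function. -/
  r : ℕ → S × A × B → ℝ
  /-- The transition densities. -/
  P : ℕ → S × A × B → S → ℝ
  H_pos : 1 ≤ H
  vol_le_one : vol Set.univ ≤ 1
  measurable_r : ∀ h < H, Measurable (r h)
  r_mem : ∀ h < H, ∀ z, r h z ∈ Set.Icc (-1 : ℝ) 1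
  measurable_P : ∀ h < H, Measurable (fun x : (S × A × B) × S => P h x.1 x.2)
  P_nonneg : ∀ h < H, ∀ z s', 0 ≤ P h z s'
  lintegral_P : ∀ h < H, ∀ z, ∫⁻ s', ENNReal.ofReal (P h z s') ∂vol = 1

/-- `Unif(a) Unif(b)`. -/
def unifActions (A B : Type*) [Fintype A] [Nonempty A] [MeasurableSpace A] [Fintype B] [Nonempty B]
    [MeasurableSpace B] : Measure (A × B) :=
  (PMF.uniformOfFintype A).toMeasure.prod (PMF.uniformOfFintype B).toMeasure

namespace MarkovGame

variable {S A B : Type*} [MeasurableSpace S] [MeasurableSpace A] [MeasurableSpace B]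

/-- The low-rank assumption on the transition kernel. -/
def IsLowRank (G : MarkovGame S A B) (d : ℕ) : Prop :=
  ∃ (ψ : ℕ → S → Feat d) (φ : ℕ → S × A × B → Feat d), ∀ h < G.H,
    (∀ z s', G.P h z s' = inner ℝ (ψ h s') (φ h z)) ∧
    (∀ z, ‖φ h z‖ ≤ 1) ∧ (∀ s', ‖ψ h s'‖ ≤ √(d : ℝ))

/-- The law of the state reached at step `h + 1` when the pair `z` at step `h` has law `m`. -/
def next (G : MarkovGame S A B) (h : ℕ) (m : Measure (S × A × B)) : Measure S :=
  G.vol.withDensity (fun s' => ∫⁻ z, ENNReal.ofReal (G.P h z s') ∂m)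

/-- `d_h^σ(s)`: the law of the state at step `h` under the true transition and the policy `σ`. -/
def stateDist (G : MarkovGame S A B) (σ : JointPolicy S A B) : ℕ → Measure S
  | 0 => Measure.dirac G.s₁
  | h + 1 => G.next h
      (((stateDist G σ h).prod (Measure.count : Measure (A × B))).withDensity
        (fun z => ENNReal.ofReal (σ h z.1 z.2)))

variable [Fintype A] [Nonempty A] [Fintype B] [Nonempty B]

/-- `d̃_h^σ(s, a, b) = d_h^σ(s) Unif(a) Unif(b)`. -/
def tildeDist (G : MarkovGame S A B) (σ : JointPolicy S A B) (h : ℕ) : Measure (S × A × B) :=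
  (G.stateDist σ h).prod (unifActions A B)

/-- `d̆_h^σ(s, a, b) = d̃_{h-1}^σ(s', a', b') P_{h-1}(s | s', a', b') Unif(a) Unif(b)`; it is used
for `1 ≤ h` only. -/
def breveDist (G : MarkovGame S A B) (σ : JointPolicy S A B) (h : ℕ) : Measure (S × A × B) :=
  (G.next (h - 1) (G.tildeDist σ (h - 1))).prod (unifActions A B)

end MarkovGame

/-- `q` is a probability density on the state space, bounded below by `C > 0`. -/
structure IsNegativeSampling {S : Type*} [MeasurableSpace S] (vol : Measure S) (q : S → ℝ)
    (C : ℝ) : Prop where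
  C_pos : 0 < C
  measurable : Measurable q
  lower : ∀ s, C ≤ q s
  lintegral : ∫⁻ s, ENNReal.ofReal (q s) ∂vol = 1

/-- The finite classes `Ψ`, `Φ` of candidate features. The products `ψ(s')ᵀφ(z)` are nonnegative, as
they stand for density ratios. -/
structure IsFunctionClass {S A B : Type*} [MeasurableSpace S] [MeasurableSpace A]
    [MeasurableSpace B] {d : ℕ} (C : ℝ) (Ψ : Finset (S → Feat d))
    (Φ : Finset (S × A × B → Feat d)) : Prop where
  measurable_psi : ∀ ψ ∈ Ψ, Measurable ψ
  measurable_phi : ∀ φ ∈ Φ, Measurable φ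
  norm_psi : ∀ ψ ∈ Ψ, ∀ s, ‖ψ s‖ ≤ √(d : ℝ) / C
  norm_phi : ∀ φ ∈ Φ, ∀ z, ‖φ z‖ ≤ 1
  nonneg : ∀ ψ ∈ Ψ, ∀ φ ∈ Φ, ∀ s' z, 0 ≤ (inner ℝ (ψ s') (φ z) : ℝ)

/-- The density ratios `f*_h(z, s') = P_h(s' | z) / q(s')` belong to the class of all products
`ψ(s')ᵀφ(z)`. -/
def IsRealizable {S A B : Type*} [MeasurableSpace S] [MeasurableSpace A] [MeasurableSpace B]
    {d : ℕ} (G : MarkovGame S A B) (q : S → ℝ) (Ψ : Finset (S → Feat d))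
    (Φ : Finset (S × A × B → Feat d)) : Prop :=
  ∀ h < G.H, ∃ ψ ∈ Ψ, ∃ φ ∈ Φ, ∀ z s', inner ℝ (ψ s') (φ z) = G.P h z s' / q s'

section Sampling

/-- One sampled transition `(z, s', y, s⁻)`: a pair `z`, a next state `s'`, a label `y`, and a
negative next state `s⁻` (recorded only if `y = 0`). -/
abbrev TransDraw (S A B : Type*) : Type _ := (S × A × B) × S × Bool × S

/-- Iteration `h < H - 1` of the sampling loop: a transition `(z̃, s̃', y, s̃⁻)` at step `h`, then
actions `(ă, b̆)` played in the state `s̃'`, a next state and a negative next state. -/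
abbrev PairDraw (S A B : Type*) : Type _ := TransDraw S A B × (A × B) × S × S

/-- Everything sampled in one round: the iterations `h < H - 1` of the loop, then the last step. -/
abbrev RoundDraw (S A B : Type*) (H : ℕ) : Type _ := (Fin (H - 1) → PairDraw S A B) × TransDraw S A B

/-- A data point `(z, s', y)`. -/
abbrev DataPoint (S A B : Type*) : Type _ := (S × A × B) × S × Bool

variable {S A B : Type*}

def TransDraw.point (x : TransDraw S A B) : DataPoint S A B :=
  (x.1, (if x.2.2.1 then x.2.1 else x.2.2.2), x.2.2.1)

/-- The second data point of an iteration; it shares the label `y` of the first one. -/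
def PairDraw.brevePoint (x : PairDraw S A B) : DataPoint S A B :=
  ((x.1.2.1, x.2.1), (if x.1.2.2.1 then x.2.2.1 else x.2.2.2), x.1.2.2.1)

/-- The transition drawn at step `h` from a pair of law `d̃_h`. -/
def RoundDraw.tilde {H : ℕ} (x : RoundDraw S A B H) (h : ℕ) : TransDraw S A B :=
  if hh : h < H - 1 then (x.1 ⟨h, hh⟩).1 else x.2

/-- The data points that one round adds to the data set of step `h`: one point for the first step,
two points for the later steps. -/
def RoundDraw.points {H : ℕ} (x : RoundDraw S A B H) (h : ℕ) : List (DataPoint S A B) :=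
  TransDraw.point (x.tilde h) ::
    (if hh : 1 ≤ h ∧ h - 1 < H - 1 then [PairDraw.brevePoint (x.1 ⟨h - 1, hh.2⟩)] else [])

/-- `D_h^k`, with multiplicities, built from the rounds `1, …, k`. -/
def dataset {H : ℕ} (X : ℕ → RoundDraw S A B H) (h : ℕ) : ℕ → List (DataPoint S A B)
  | 0 => []
  | k + 1 => dataset X h k ++ (X (k + 1)).points h

variable [MeasurableSpace S] [MeasurableSpace A] [MeasurableSpace B]
  [Fintype A] [Nonempty A] [Fintype B] [Nonempty B]

/-- Law of `(z, s', y, s⁻)` with `z ∼ d̃_h^σ`, `s' ∼ P_h(· | z)`, `y ∼ Ber(1/2)`, `s⁻ ∼ q`. -/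
def transLaw (G : MarkovGame S A B) (q : S → ℝ) (σ : JointPolicy S A B) (h : ℕ) :
    Measure (TransDraw S A B) :=
  ((G.tildeDist σ h).prod (G.vol.prod ((PMF.uniformOfFintype Bool).toMeasure.prod
    (G.vol.withDensity (fun s => ENNReal.ofReal (q s)))))).withDensity
      (fun x => ENNReal.ofReal (G.P h x.1 x.2.1))

/-- Law of one iteration of the sampling loop, for `h < H - 1`. -/
def pairLaw (G : MarkovGame S A B) (q : S → ℝ) (σ : JointPolicy S A B) (h : ℕ) :
    Measure (PairDraw S A B) :=
  ((transLaw G q σ h).prod ((unifActions A B).prod (G.vol.prod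
    (G.vol.withDensity (fun s => ENNReal.ofReal (q s)))))).withDensity
      (fun x => ENNReal.ofReal (G.P (h + 1) (x.1.2.1, x.2.1) x.2.2.1))

/-- Law of all the draws of one round that executes the policy `σ`; the iterations are
independent. -/
def roundLaw (G : MarkovGame S A B) (q : S → ℝ) (σ : JointPolicy S A B) :
    Measure (RoundDraw S A B G.H) :=
  (Measure.pi (fun h : Fin (G.H - 1) => pairLaw G q σ h)).prod (transLaw G q σ (G.H - 1))

end Sampling

section Learning

variable {S A B : Type*} {d : ℕ}

/-- `y log (1 + 1 / f) + (1 - y) log (1 + f)` for `f ≥ 0`, with value `∞` for `y = 1`, `f = 0`. -/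
def pointLoss (f : ℝ) (y : Bool) : ℝ≥0∞ :=
  if y then (if f = 0 then ⊤ else ENNReal.ofReal (Real.log (1 + 1 / f)))
  else ENNReal.ofReal (Real.log (1 + f))

/-- The contrastive loss: the average of the pointwise loss over the data. -/
def contrastiveLoss (ψ : S → Feat d) (φ : S × A × B → Feat d) (D : List (DataPoint S A B)) : ℝ≥0∞ :=
  (D.map (fun x => pointLoss (inner ℝ (ψ x.2.1) (φ x.1)) x.2.2)).sum / (D.length : ℝ≥0∞)

/-- `(ψ, φ)` minimizes the contrastive loss over `Ψ × Φ`. -/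
def IsContrastiveMin (Ψ : Finset (S → Feat d)) (Φ : Finset (S × A × B → Feat d))
    (D : List (DataPoint S A B)) (ψ : S → Feat d) (φ : S × A × B → Feat d) : Prop :=
  ψ ∈ Ψ ∧ φ ∈ Φ ∧ ∀ ψ' ∈ Ψ, ∀ φ' ∈ Φ, contrastiveLoss ψ φ D ≤ contrastiveLoss ψ' φ' D

/-- Normalized features `ψ̂(s') = q(s') ψ̃(s')`. -/
def psiHat (q : S → ℝ) (ψ : S → Feat d) (s' : S) : Feat d := q s' • ψ s'

/-- Normalized features `φ̂(z) = φ̃(z) / ∫ q(s') φ̃(z)ᵀψ̃(s') ds'`. -/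
def phiHat [MeasurableSpace S] (vol : Measure S) (q : S → ℝ) (ψ : S → Feat d)
    (φ : S × A × B → Feat d) (z : S × A × B) : Feat d :=
  (∫ s', q s' * inner ℝ (φ z) (ψ s') ∂vol)⁻¹ • φ z

/-- The estimated transition `P̂(s' | z) = ψ̂(s')ᵀφ̂(z)`. -/
def pHat [MeasurableSpace S] (vol : Measure S) (q : S → ℝ) (ψ : S → Feat d)
    (φ : S × A × B → Feat d) (z : S × A × B) (s' : S) : ℝ :=
  inner ℝ (psiHat q ψ s') (phiHat vol q ψ φ z)

/-- `(1/k) ∑_τ v_τ v_τᵀ + lam I`. -/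
def empCov (k : ℕ) (lam : ℝ) (v : ℕ → Feat d) : Matrix (Fin d) (Fin d) ℝ :=
  (1 / (k : ℝ)) • (∑ τ ∈ Finset.Icc 1 k, Matrix.vecMulVec (fun i => v τ i) (fun i => v τ i)) +
    lam • (1 : Matrix (Fin d) (Fin d) ℝ)

/-- The bonus `min {gam ‖v‖_{M⁻¹}, 2H}`. -/
def bonus (gam : ℝ) (H : ℕ) (M : Matrix (Fin d) (Fin d) ℝ) (v : Feat d) : ℝ :=
  min (gam * √((fun i => v i) ⬝ᵥ (M⁻¹.mulVec (fun i => v i)))) (2 * (H : ℝ))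

/-- `m` is an `iota`-coarse correlated equilibrium of the payoff matrices `Qup`, `Qlo`. -/
structure IsCCE [Fintype A] [Fintype B] (iota : ℝ) (Qup Qlo : A × B → ℝ) (m : A × B → ℝ) :
    Prop where
  nonneg : ∀ c, 0 ≤ m c
  sum_eq_one : ∑ c, m c = 1
  fst : ∀ a', ∑ c, m c * Qup c ≥ (∑ b, (∑ a, m (a, b)) * Qup (a', b)) - iota
  snd : ∀ b', ∑ c, m c * Qlo c ≤ (∑ a, (∑ b, m (a, b)) * Qlo (a, b')) + iota

end Learning

/-- An execution of Contrastive ULCB for `K` rounds on a probability space `(Ω, μ)`. Ties (the choice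
of a minimizer and of an equilibrium) are broken in any way, randomly if desired, that depends on the
past only. The parameters `lam k`, `gam k`, `iota k` are those of round `k`. -/
structure ContrastiveULCB {S A B Ω : Type*} [MeasurableSpace S]
    [Fintype A] [Nonempty A] [MeasurableSpace A] [Fintype B] [Nonempty B] [MeasurableSpace B]
    [mΩ : MeasurableSpace Ω] (μ : Measure Ω) {d : ℕ} (G : MarkovGame S A B) (q : S → ℝ)
    (Ψ : Finset (S → Feat d)) (Φ : Finset (S × A × B → Feat d))
    (lam gam iota : ℕ → ℝ) (K : ℕ) where
  /-- The information available after each round. -/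
  𝓕 : Filtration ℕ mΩ
  /-- The draws of round `k`. -/
  X : ℕ → Ω → RoundDraw S A B G.H
  /-- The joint policy computed in round `k`. -/
  σ : ℕ → Ω → JointPolicy S A B
  /-- The minimizer `ψ̃_h^k`. -/
  ψt : ℕ → ℕ → Ω → S → Feat d
  /-- The minimizer `φ̃_h^k`. -/
  φt : ℕ → ℕ → Ω → S × A × B → Feat d
  /-- Upper and lower confidence Q-functions and value functions. -/
  Qup : ℕ → ℕ → Ω → S × A × B → ℝ
  Qlo : ℕ → ℕ → Ω → S × A × B → ℝ
  Vup : ℕ → ℕ → Ω → S → ℝ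
  Vlo : ℕ → ℕ → Ω → S → ℝ
  init : ∀ ω, ∀ h < G.H, ∀ s c,
    σ 0 ω h s c = 1 / ((Fintype.card A : ℝ) * (Fintype.card B : ℝ))
  measurable_X : ∀ k, 1 ≤ k → k ≤ K → Measurable[𝓕 k] (X k)
  measurable_σ : ∀ k ≤ K, ∀ h < G.H, ∀ c : A × B,
    Measurable[(𝓕 k).prod inferInstance] (fun x : Ω × S => σ k x.1 h x.2 c)
  /-- Given the past, the draws of round `k + 1` have the sampling law of the policy computed in
  round `k`. -/
  cond_law : ∀ k < K, ∀ E, MeasurableSet[𝓕 k] E → ∀ U, MeasurableSet U →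
    μ (E ∩ X (k + 1) ⁻¹' U) = ∫⁻ ω in E, roundLaw G q (σ k ω) U ∂μ
  argmin : ∀ k, 1 ≤ k → k ≤ K → ∀ h < G.H, ∀ ω,
    IsContrastiveMin Ψ Φ (dataset (fun τ => X τ ω) h k) (ψt k h ω) (φt k h ω)
  measurable_ψt : ∀ k, 1 ≤ k → k ≤ K → ∀ h < G.H, ∀ ψ ∈ Ψ, MeasurableSet[𝓕 k] {ω | ψt k h ω = ψ}
  measurable_φt : ∀ k, 1 ≤ k → k ≤ K → ∀ h < G.H, ∀ φ ∈ Φ, MeasurableSet[𝓕 k] {ω | φt k h ω = φ}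
  Vup_last : ∀ k, 1 ≤ k → k ≤ K → ∀ ω s, Vup k G.H ω s = 0
  Vlo_last : ∀ k, 1 ≤ k → k ≤ K → ∀ ω s, Vlo k G.H ω s = 0
  Qup_eq : ∀ k, 1 ≤ k → k ≤ K → ∀ h < G.H, ∀ ω z, Qup k h ω z =
    G.r h z + ∫ s', pHat G.vol q (ψt k h ω) (φt k h ω) z s' * Vup k (h + 1) ω s' ∂G.vol +
      bonus (gam k) G.H
        (empCov k (lam k) (fun τ => phiHat G.vol q (ψt k h ω) (φt k h ω) ((X τ ω).tilde h).1))
        (phiHat G.vol q (ψt k h ω) (φt k h ω) z)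
  Qlo_eq : ∀ k, 1 ≤ k → k ≤ K → ∀ h < G.H, ∀ ω z, Qlo k h ω z =
    G.r h z + ∫ s', pHat G.vol q (ψt k h ω) (φt k h ω) z s' * Vlo k (h + 1) ω s' ∂G.vol -
      bonus (gam k) G.H
        (empCov k (lam k) (fun τ => phiHat G.vol q (ψt k h ω) (φt k h ω) ((X τ ω).tilde h).1))
        (phiHat G.vol q (ψt k h ω) (φt k h ω) z)
  Vup_eq : ∀ k, 1 ≤ k → k ≤ K → ∀ h < G.H, ∀ ω s,
    Vup k h ω s = ∑ c, σ k ω h s c * Qup k h ω (s, c)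
  Vlo_eq : ∀ k, 1 ≤ k → k ≤ K → ∀ h < G.H, ∀ ω s,
    Vlo k h ω s = ∑ c, σ k ω h s c * Qlo k h ω (s, c)
  cce : ∀ k, 1 ≤ k → k ≤ K → ∀ h < G.H, ∀ ω s,
    IsCCE (iota k) (fun c => Qup k h ω (s, c)) (fun c => Qlo k h ω (s, c)) (σ k ω h s)

namespace ContrastiveULCB

variable {S A B Ω : Type*} [MeasurableSpace S]
  [Fintype A] [Nonempty A] [MeasurableSpace A] [Fintype B] [Nonempty B] [MeasurableSpace B]
  [MeasurableSpace Ω] {μ : Measure Ω} {d : ℕ} {G : MarkovGame S A B} {q : S → ℝ}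
  {Ψ : Finset (S → Feat d)} {Φ : Finset (S × A × B → Feat d)} {lam gam iota : ℕ → ℝ} {K : ℕ}

/-- `ρ̃_h^k = (1/k) ∑_{k' < k} d̃_h^{σ^{k'}}`. -/
def tildeRho (R : ContrastiveULCB μ G q Ψ Φ lam gam iota K) (k h : ℕ) (ω : Ω) :
    Measure (S × A × B) :=
  (k : ℝ≥0∞)⁻¹ • ∑ k' ∈ Finset.range k, G.tildeDist (R.σ k' ω) h

/-- `ρ̆_h^k = (1/k) ∑_{k' < k} d̆_h^{σ^{k'}}`. -/
def breveRho (R : ContrastiveULCB μ G q Ψ Φ lam gam iota K) (k h : ℕ) (ω : Ω) :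
    Measure (S × A × B) :=
  (k : ℝ≥0∞)⁻¹ • ∑ k' ∈ Finset.range k, G.breveDist (R.σ k' ω) h

/-- `‖P_h(· | z) - P̂_h^k(· | z)‖₁`. -/
def l1Error (R : ContrastiveULCB μ G q Ψ Φ lam gam iota K) (k h : ℕ) (ω : Ω) (z : S × A × B) :
    ℝ≥0∞ :=
  ∫⁻ s', ENNReal.ofReal |G.P h z s' - pHat G.vol q (R.ψt k h ω) (R.φt k h ω) z s'| ∂G.vol

/-- `ζ_h^k`, the mean of the squared error under `ρ̃_h^k`. -/
def zeta (R : ContrastiveULCB μ G q Ψ Φ lam gam iota K) (k h : ℕ) (ω : Ω) : ℝ≥0∞ :=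
  ∫⁻ z, R.l1Error k h ω z ^ 2 ∂(R.tildeRho k h ω)

/-- `ξ_h^k`, the mean of the squared error under `ρ̆_h^k`. -/
def xi (R : ContrastiveULCB μ G q Ψ Φ lam gam iota K) (k h : ℕ) (ω : Ω) : ℝ≥0∞ :=
  ∫⁻ z, R.l1Error k h ω z ^ 2 ∂(R.breveRho k h ω)

end ContrastiveULCB

end

/-!
The contrastive loss is the negative log-likelihood of the labels `y` when the label is `1` with
probability `f / (1 + f)`, and the true label law is the one of the ratio `g = P / q`, which belongs to
the class. The proof is the exponential-moment argument for maximum likelihood, on martingale data.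

For one candidate `f` the weight of a data point is the square root of the likelihood ratio of `f`
and `g` (`ratioWeight`). Its conditional mean at the pair `z` is a Hellinger affinity, `1 - D(z)`
say, with `D ≥ 0` (`pointMean_ratioWeight`). One round adds to step `h` a point with
`z ∼ d̃_h^σ` and, for `h ≥ 1`, an independent one with `z ∼ d̆_h^σ` (`lintegral_roundWeight_succ`),
so that by `1 - u ≤ exp (-u)` the product of all weights, times the exponential of the sum of the
means of `D` under these laws, is a nonnegative supermartingale
(`ContrastiveULCB.lintegral_compensatedWeight_le_one`). By Markov's inequality and a union bound over
`h`, `ψ` and `φ`, with probability at least `1 - δ` none of these processes exceeds `H |F| / δ` after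
`k` rounds. The product of the weights of the minimizer is at least one because the truth is a
competitor (`one_le_prod_sqrtRatio`), hence the sum of the means of its `D` is at most
`log (H |F| / δ)`, and this bounds both kinds of pairs at once.

It remains to compare `D(z)` with the `L¹` error. With `f = tan² α` and `g = tan² β`, the density of
`D` with respect to `q` is `(1 + g) (1 - cos (α - β)) / 2`, which is at least
`(√f - √g)² / (4 (1 + M))` if `f ≤ M` (`sq_sub_sqrt_le_sub_affDensity`). The integral of
`(√f - √g)²` is at least a quarter of the squared `L¹` distance between `g` and the normalization of
`f`, by the Cauchy-Schwarz inequality (`sq_integral_abs_sub_normalized_le`). This gives the constant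
`16 (1 + M)` with `M = √d / C`, and `M ≥ 1` since `g ≤ M` has mean one under `q`.
-/

/-! ### Integration against the laws of the game -/

section StateLaws

variable {S A B : Type*} [MeasurableSpace S] [MeasurableSpace A] [MeasurableSpace B]

instance MarkovGame.isFiniteMeasure_vol (G : MarkovGame S A B) : IsFiniteMeasure G.vol :=
  ⟨G.vol_le_one.trans_lt ENNReal.one_lt_top⟩

theorem IsNegativeSampling.isProbabilityMeasure {vol : Measure S} {q : S → ℝ} {C : ℝ}
    (hq : IsNegativeSampling vol q C) :
    IsProbabilityMeasure (vol.withDensity (fun s => ENNReal.ofReal (q s))) :=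
  ⟨by rw [withDensity_apply _ MeasurableSet.univ, Measure.restrict_univ, hq.lintegral]⟩

theorem lintegral_prod_withDensity {X Y : Type*} [MeasurableSpace X] [MeasurableSpace Y]
    {m : Measure X} {ρ : Measure Y} [SFinite ρ] {D g : X × Y → ℝ≥0∞}
    (hD : Measurable D) (hg : Measurable g) :
    ∫⁻ x, g x ∂((m.prod ρ).withDensity D) = ∫⁻ x, ∫⁻ y, D (x, y) * g (x, y) ∂ρ ∂m := by
  rw [lintegral_withDensity_eq_lintegral_mul _ hD hg, lintegral_prod _ (hD.mul hg).aemeasurable]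
  rfl

theorem measurable_ofReal_P (G : MarkovGame S A B) {h : ℕ} (hh : h < G.H) :
    Measurable (fun x : (S × A × B) × S => ENNReal.ofReal (G.P h x.1 x.2)) :=
  (G.measurable_P h hh).ennreal_ofReal

theorem lintegral_next (G : MarkovGame S A B) {h : ℕ} (hh : h < G.H) (m : Measure (S × A × B))
    [SFinite m] {g : S → ℝ≥0∞} (hg : Measurable g) :
    ∫⁻ s', g s' ∂(G.next h m) = ∫⁻ z, ∫⁻ s', ENNReal.ofReal (G.P h z s') * g s' ∂G.vol ∂m := by
  have hP := measurable_ofReal_P G hh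
  have hP' : Measurable (fun x : S × (S × A × B) => ENNReal.ofReal (G.P h x.2 x.1)) :=
    hP.comp measurable_swap
  rw [MarkovGame.next, lintegral_withDensity_eq_lintegral_mul _ hP'.lintegral_prod_right' hg]
  rw [lintegral_lintegral_swap (hP.mul (hg.comp measurable_snd)).aemeasurable]
  refine lintegral_congr fun s' => ?_
  simp only [Pi.mul_apply]
  rw [lintegral_mul_const]
  exact hP'.comp measurable_prodMk_left

instance sFinite_next (G : MarkovGame S A B) (h : ℕ) (m : Measure (S × A × B)) :
    SFinite (G.next h m) := by
  unfold MarkovGame.next; infer_instance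

theorem isProbabilityMeasure_next (G : MarkovGame S A B) {h : ℕ} (hh : h < G.H)
    (m : Measure (S × A × B)) [IsProbabilityMeasure m] : IsProbabilityMeasure (G.next h m) := by
  refine ⟨?_⟩
  rw [← lintegral_one, lintegral_next G hh m measurable_const]
  simp [G.lintegral_P h hh]

variable [Fintype A] [Fintype B]

/-- `σ h s` is a probability vector that depends measurably on `s`, at each of the steps `h < H`.
This is what makes the trajectory laws of `σ` probability measures. -/
structure IsPolicy (H : ℕ) (σ : JointPolicy S A B) : Prop where
  measurable : ∀ h < H, ∀ c, Measurable (fun s => σ h s c)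
  nonneg : ∀ h < H, ∀ s c, 0 ≤ σ h s c
  sum_eq_one : ∀ h < H, ∀ s, ∑ c, σ h s c = 1

instance sFinite_stateDist (G : MarkovGame S A B) (σ : JointPolicy S A B)
    (h : ℕ) : SFinite (G.stateDist σ h) := by
  cases h <;> simp only [MarkovGame.stateDist] <;> infer_instance

variable [MeasurableSingletonClass A] [MeasurableSingletonClass B]

/-- One step of the trajectory law: an action from the policy, then a transition. -/
theorem lintegral_stateDist_succ (G : MarkovGame S A B) {σ : JointPolicy S A B} {h : ℕ}
    (hh : h < G.H) (hσ : ∀ c, Measurable (fun s => σ h s c)) {g : S → ℝ≥0∞} (hg : Measurable g) :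
    ∫⁻ s, g s ∂(G.stateDist σ (h + 1)) = ∫⁻ s, ∑ c, ENNReal.ofReal (σ h s c) *
      ∫⁻ s', ENNReal.ofReal (G.P h (s, c) s') * g s' ∂G.vol ∂(G.stateDist σ h) := by
  have hm : Measurable (fun z : S × A × B => ENNReal.ofReal (σ h z.1 z.2)) :=
    (measurable_from_prod_countable_left hσ).ennreal_ofReal
  have hP : Measurable (fun x : (S × A × B) × S => ENNReal.ofReal (G.P h x.1 x.2) * g x.2) :=
    (measurable_ofReal_P G hh).mul (hg.comp measurable_snd)
  rw [MarkovGame.stateDist, lintegral_next G hh _ hg,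
    lintegral_prod_withDensity hm hP.lintegral_prod_right']
  simp [lintegral_count, tsum_fintype]

/-- The law of a state depends measurably on a parameter of the policy. -/
theorem measurable_lintegral_stateDist {Ω' : Type*} {mΩ' : MeasurableSpace Ω'} (G : MarkovGame S A B)
    {σ : Ω' → JointPolicy S A B}
    (hσ : ∀ h < G.H, ∀ c : A × B, Measurable (fun x : Ω' × S => σ x.1 h x.2 c)) {h : ℕ}
    (hh : h ≤ G.H) {g : Ω' × S → ℝ≥0∞} (hg : Measurable g) :
    Measurable (fun ω => ∫⁻ s, g (ω, s) ∂(G.stateDist (σ ω) h)) := by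
  induction h generalizing g with
  | zero =>
    simp only [MarkovGame.stateDist]
    have : (fun ω => ∫⁻ s, g (ω, s) ∂(Measure.dirac G.s₁)) = fun ω => g (ω, G.s₁) := by
      ext ω
      exact lintegral_dirac' _ (hg.comp measurable_prodMk_left)
    rw [this]
    exact hg.comp measurable_prodMk_right
  | succ h ih =>
    have hh' : h < G.H := hh
    have e : ∀ ω, ∫⁻ s, g (ω, s) ∂(G.stateDist (σ ω) (h + 1)) =
        ∫⁻ s, ∑ c, ENNReal.ofReal (σ ω h s c) *
          ∫⁻ s', ENNReal.ofReal (G.P h (s, c) s') * g (ω, s') ∂G.vol ∂(G.stateDist (σ ω) h) :=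
      fun ω => lintegral_stateDist_succ G hh' (fun c => (hσ h hh' c).comp measurable_prodMk_left)
        (hg.comp measurable_prodMk_left)
    simp only [e]
    refine ih (g := fun x : Ω' × S => ∑ c, ENNReal.ofReal (σ x.1 h x.2 c) *
      ∫⁻ s', ENNReal.ofReal (G.P h (x.2, c) s') * g (x.1, s') ∂G.vol) hh'.le ?_
    refine Finset.measurable_sum _ fun c _ => (hσ h hh' c).ennreal_ofReal.mul ?_
    refine Measurable.lintegral_prod_right'
      (f := fun y : (Ω' × S) × S => ENNReal.ofReal (G.P h (y.1.2, c) y.2) * g (y.1.1, y.2)) ?_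
    exact ((measurable_ofReal_P G hh').comp
      (by fun_prop : Measurable (fun y : (Ω' × S) × S => ((y.1.2, c), y.2)))).mul
      (hg.comp (by fun_prop : Measurable (fun y : (Ω' × S) × S => (y.1.1, y.2))))

theorem isProbabilityMeasure_stateDist (G : MarkovGame S A B) {σ : JointPolicy S A B}
    (hσ : IsPolicy G.H σ) {h : ℕ} (hh : h ≤ G.H) : IsProbabilityMeasure (G.stateDist σ h) := by
  induction h with
  | zero => simp only [MarkovGame.stateDist]; infer_instance
  | succ h ih =>
    have hh' : h < G.H := hh
    have := ih hh'.le
    refine ⟨?_⟩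
    rw [← lintegral_one, lintegral_stateDist_succ G hh' (hσ.measurable h hh') measurable_const]
    simp only [mul_one, G.lintegral_P h hh']
    simp_rw [← ENNReal.ofReal_sum_of_nonneg (fun c _ => hσ.nonneg h hh' _ c),
      hσ.sum_eq_one h hh']
    simp

end StateLaws

section PairLaws

variable {S A B : Type*} [MeasurableSpace S] [MeasurableSpace A] [MeasurableSpace B]

variable [Fintype A] [Nonempty A] [Fintype B] [Nonempty B]

instance isProbabilityMeasure_unifActions : IsProbabilityMeasure (unifActions A B) := by
  unfold unifActions; infer_instance

instance sFinite_tildeDist (G : MarkovGame S A B) (σ : JointPolicy S A B) (h : ℕ) :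
    SFinite (G.tildeDist σ h) := by
  unfold MarkovGame.tildeDist; infer_instance

theorem lintegral_breveDist (G : MarkovGame S A B) (σ : JointPolicy S A B) {h : ℕ}
    (hh : h < G.H) {g : S × A × B → ℝ≥0∞} (hg : Measurable g) :
    ∫⁻ z, g z ∂(G.breveDist σ h) = ∫⁻ z, ∫⁻ s', ENNReal.ofReal (G.P (h - 1) z s') *
      ∫⁻ c, g (s', c) ∂(unifActions A B) ∂G.vol ∂(G.tildeDist σ (h - 1)) := by
  rw [MarkovGame.breveDist, lintegral_prod _ hg.aemeasurable,
    lintegral_next G (by omega) _ hg.lintegral_prod_right']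

variable [MeasurableSingletonClass A] [MeasurableSingletonClass B]

theorem isProbabilityMeasure_tildeDist (G : MarkovGame S A B) {σ : JointPolicy S A B}
    (hσ : IsPolicy G.H σ) {h : ℕ} (hh : h ≤ G.H) : IsProbabilityMeasure (G.tildeDist σ h) := by
  have := isProbabilityMeasure_stateDist G hσ hh
  unfold MarkovGame.tildeDist; infer_instance

theorem isProbabilityMeasure_breveDist (G : MarkovGame S A B) {σ : JointPolicy S A B}
    (hσ : IsPolicy G.H σ) {h : ℕ} (hh : h < G.H) : IsProbabilityMeasure (G.breveDist σ h) := by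
  have h' : h - 1 < G.H := by omega
  have := isProbabilityMeasure_tildeDist G hσ h'.le
  have := isProbabilityMeasure_next G h' (G.tildeDist σ (h - 1))
  unfold MarkovGame.breveDist; infer_instance

theorem measurable_lintegral_tildeDist {Ω' : Type*} {mΩ' : MeasurableSpace Ω'} (G : MarkovGame S A B)
    {σ : Ω' → JointPolicy S A B}
    (hσ : ∀ h < G.H, ∀ c : A × B, Measurable (fun x : Ω' × S => σ x.1 h x.2 c)) {h : ℕ}
    (hh : h ≤ G.H) {g : Ω' × (S × A × B) → ℝ≥0∞} (hg : Measurable g) :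
    Measurable (fun ω => ∫⁻ z, g (ω, z) ∂(G.tildeDist (σ ω) h)) := by
  simp only [MarkovGame.tildeDist]
  have e : ∀ ω, ∫⁻ z, g (ω, z) ∂((G.stateDist (σ ω) h).prod (unifActions A B)) =
      ∫⁻ s, ∫⁻ c, g (ω, (s, c)) ∂(unifActions A B) ∂(G.stateDist (σ ω) h) := fun ω =>
    lintegral_prod _ (hg.comp measurable_prodMk_left).aemeasurable
  simp only [e]
  refine measurable_lintegral_stateDist G hσ hh
    (g := fun x : Ω' × S => ∫⁻ c, g (x.1, (x.2, c)) ∂(unifActions A B)) ?_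
  refine Measurable.lintegral_prod_right'
    (f := fun y : (Ω' × S) × (A × B) => g (y.1.1, (y.1.2, y.2))) (hg.comp ?_)
  fun_prop

theorem measurable_lintegral_breveDist {Ω' : Type*} {mΩ' : MeasurableSpace Ω'} (G : MarkovGame S A B)
    {σ : Ω' → JointPolicy S A B}
    (hσ : ∀ h < G.H, ∀ c : A × B, Measurable (fun x : Ω' × S => σ x.1 h x.2 c)) {h : ℕ}
    (hh : h < G.H) {g : S × A × B → ℝ≥0∞} (hg : Measurable g) :
    Measurable (fun ω => ∫⁻ z, g z ∂(G.breveDist (σ ω) h)) := by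
  simp only [fun ω => lintegral_breveDist G (σ ω) hh hg]
  have h' : h - 1 < G.H := by omega
  refine measurable_lintegral_tildeDist G hσ h'.le (g := fun x : Ω' × (S × A × B) =>
    ∫⁻ s', ENNReal.ofReal (G.P (h - 1) x.2 s') * ∫⁻ c, g (s', c) ∂(unifActions A B) ∂G.vol) ?_
  have : Measurable (fun x : (S × A × B) × S => ENNReal.ofReal (G.P (h - 1) x.1 x.2) *
      ∫⁻ c, g (x.2, c) ∂(unifActions A B)) :=
    (measurable_ofReal_P G h').mul (hg.lintegral_prod_right'.comp measurable_snd)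
  exact this.lintegral_prod_right'.comp measurable_snd

end PairLaws

/-! ### The sampling law of one round -/

section RoundLaw

variable {S A B : Type*} [MeasurableSpace S] [MeasurableSpace A] [MeasurableSpace B]

/-- The mean of `w` at a data point whose first component is `z`: with probability one half it is
`(z, s', 1)` with `s' ∼ P_h(· | z)`, otherwise `(z, s', 0)` with `s' ∼ q`. -/
noncomputable def pointMean (G : MarkovGame S A B) (q : S → ℝ) (h : ℕ)
    (w : DataPoint S A B → ℝ≥0∞) (z : S × A × B) : ℝ≥0∞ :=
  (2 : ℝ≥0∞)⁻¹ * (∫⁻ s', ENNReal.ofReal (G.P h z s') * w (z, s', true) ∂G.vol +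
    ∫⁻ s', ENNReal.ofReal (q s') * w (z, s', false) ∂G.vol)

theorem lintegral_uniform_bool (g : Bool → ℝ≥0∞) :
    ∫⁻ y, g y ∂(PMF.uniformOfFintype Bool).toMeasure = 2⁻¹ * (g true + g false) := by
  rw [lintegral_fintype]
  simp [PMF.uniformOfFintype_apply]
  ring

theorem measurable_pointMean (G : MarkovGame S A B) {q : S → ℝ} (hq : Measurable q) {h : ℕ}
    (hh : h < G.H) {w : DataPoint S A B → ℝ≥0∞} (hw : Measurable w) :
    Measurable (pointMean G q h w) := by
  have h1 : Measurable (fun x : (S × A × B) × S =>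
      ENNReal.ofReal (G.P h x.1 x.2) * w (x.1, x.2, true)) :=
    (measurable_ofReal_P G hh).mul (hw.comp (by fun_prop))
  have h0 : Measurable (fun x : (S × A × B) × S =>
      ENNReal.ofReal (q x.2) * w (x.1, x.2, false)) :=
    (hq.comp measurable_snd).ennreal_ofReal.mul (hw.comp (by fun_prop))
  exact (h1.lintegral_prod_right'.add h0.lintegral_prod_right').const_mul _

theorem pointMean_one (G : MarkovGame S A B) {q : S → ℝ} {C : ℝ}
    (hq : IsNegativeSampling G.vol q C) {h : ℕ} (hh : h < G.H) (z : S × A × B) :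
    pointMean G q h (fun _ => 1) z = 1 := by
  simp only [pointMean, mul_one, G.lintegral_P h hh, hq.lintegral]
  rw [one_add_one_eq_two]
  exact ENNReal.inv_mul_cancel (by simp) (by simp)

theorem measurable_point : Measurable (TransDraw.point : TransDraw S A B → DataPoint S A B) := by
  have hy : Measurable (fun x : TransDraw S A B => x.2.2.1) := by fun_prop
  refine Measurable.prodMk (by fun_prop) (Measurable.prodMk ?_ hy)
  exact Measurable.ite (hy (measurableSet_singleton true)) (by fun_prop) (by fun_prop)

theorem measurable_brevePoint :
    Measurable (PairDraw.brevePoint : PairDraw S A B → DataPoint S A B) := by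
  have hy : Measurable (fun x : PairDraw S A B => x.1.2.2.1) := by fun_prop
  refine Measurable.prodMk (by fun_prop) (Measurable.prodMk ?_ hy)
  exact Measurable.ite (hy (measurableSet_singleton true)) (by fun_prop) (by fun_prop)

theorem measurable_tilde {H : ℕ} (h : ℕ) :
    Measurable (fun x : RoundDraw S A B H => x.tilde h) := by
  unfold RoundDraw.tilde
  split_ifs <;> fun_prop

/-- The product of the weights of the data points that one round adds to step `h`. -/
noncomputable def roundWeight {H : ℕ} (w : DataPoint S A B → ℝ≥0∞) (h : ℕ)
    (x : RoundDraw S A B H) : ℝ≥0∞ :=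
  ((x.points h).map w).prod

theorem measurable_roundWeight {H : ℕ} {w : DataPoint S A B → ℝ≥0∞} (hw : Measurable w) (h : ℕ) :
    Measurable (fun x : RoundDraw S A B H => roundWeight w h x) := by
  have h1 : Measurable (fun x : RoundDraw S A B H => w (TransDraw.point (x.tilde h))) :=
    hw.comp (measurable_point.comp (measurable_tilde h))
  unfold roundWeight RoundDraw.points
  split_ifs with hh
  · simp only [List.map_cons, List.map_nil, List.prod_cons, List.prod_nil, mul_one]
    exact h1.mul (hw.comp (measurable_brevePoint.comp (by fun_prop)))
  · simpa using h1

variable [Fintype A] [Nonempty A] [Fintype B] [Nonempty B]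

theorem lintegral_transLaw (G : MarkovGame S A B) (q : S → ℝ) (σ : JointPolicy S A B) {h : ℕ}
    (hh : h < G.H) {g : TransDraw S A B → ℝ≥0∞} (hg : Measurable g) :
    ∫⁻ x, g x ∂(transLaw G q σ h) = ∫⁻ z, ∫⁻ y, ENNReal.ofReal (G.P h z y.1) * g (z, y)
      ∂(G.vol.prod ((PMF.uniformOfFintype Bool).toMeasure.prod
        (G.vol.withDensity (fun s => ENNReal.ofReal (q s))))) ∂(G.tildeDist σ h) := by
  have hP := measurable_ofReal_P G hh
  exact lintegral_prod_withDensity (hP.comp (by fun_prop :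
    Measurable (fun x : TransDraw S A B => (x.1, x.2.1)))) hg

theorem lintegral_pairLaw (G : MarkovGame S A B) (q : S → ℝ) (σ : JointPolicy S A B) {h : ℕ}
    (hh : h + 1 < G.H) {g : PairDraw S A B → ℝ≥0∞} (hg : Measurable g) :
    ∫⁻ x, g x ∂(pairLaw G q σ h) = ∫⁻ x, ∫⁻ y,
      ENNReal.ofReal (G.P (h + 1) (x.2.1, y.1) y.2.1) * g (x, y)
      ∂((unifActions A B).prod (G.vol.prod
        (G.vol.withDensity (fun s => ENNReal.ofReal (q s))))) ∂(transLaw G q σ h) := by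
  have hP := measurable_ofReal_P G hh
  exact lintegral_prod_withDensity (hP.comp (by fun_prop :
    Measurable (fun x : PairDraw S A B => ((x.1.2.1, x.2.1), x.2.2.1)))) hg

theorem lintegral_transLaw_point (G : MarkovGame S A B) {q : S → ℝ} {C : ℝ}
    (hq : IsNegativeSampling G.vol q C) (σ : JointPolicy S A B) {h : ℕ}
    (hh : h < G.H) {w : DataPoint S A B → ℝ≥0∞} (hw : Measurable w) :
    ∫⁻ x, w (TransDraw.point x) ∂(transLaw G q σ h) =
      ∫⁻ z, pointMean G q h w z ∂(G.tildeDist σ h) := by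
  have := hq.isProbabilityMeasure
  rw [lintegral_transLaw G q σ hh (g := fun x => w (TransDraw.point x))
    (hw.comp measurable_point)]
  refine lintegral_congr fun z => ?_
  have hP : Measurable (fun s' => ENNReal.ofReal (G.P h z s')) :=
    (measurable_ofReal_P G hh).comp measurable_prodMk_left
  have hm : Measurable (fun y : S × Bool × S =>
      ENNReal.ofReal (G.P h z y.1) * w (TransDraw.point (z, y))) :=
    (hP.comp measurable_fst).mul (hw.comp (measurable_point.comp measurable_prodMk_left))
  have hw' : ∀ b, Measurable (fun s' => w (z, s', b)) := fun b => hw.comp (by fun_prop)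
  have hq' : Measurable (fun s => ENNReal.ofReal (q s)) := hq.measurable.ennreal_ofReal
  have e : ∫⁻ s, w (z, s, false) ∂(G.vol.withDensity (fun s => ENNReal.ofReal (q s))) =
      ∫⁻ s', ENNReal.ofReal (q s') * w (z, s', false) ∂G.vol :=
    lintegral_withDensity_eq_lintegral_mul _ hq' (hw' false)
  rw [lintegral_prod _ hm.aemeasurable]
  have e2 : ∀ s', ∫⁻ y, ENNReal.ofReal (G.P h z s') * w (TransDraw.point (z, s', y))
      ∂((PMF.uniformOfFintype Bool).toMeasure.prod
        (G.vol.withDensity (fun s => ENNReal.ofReal (q s)))) =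
      2⁻¹ * (ENNReal.ofReal (G.P h z s') * w (z, s', true) + ENNReal.ofReal (G.P h z s') *
        ∫⁻ s', ENNReal.ofReal (q s') * w (z, s', false) ∂G.vol) := by
    intro s'
    rw [lintegral_prod _ (by exact (hm.comp measurable_prodMk_left).aemeasurable),
      lintegral_uniform_bool]
    simp only [TransDraw.point, if_true, Bool.false_eq_true, if_false]
    rw [lintegral_const_mul _ (hw' false), e, lintegral_const, measure_univ, mul_one]
  simp only [e2]
  rw [lintegral_const_mul, lintegral_add_left (by exact hP.mul (hw' true)), lintegral_mul_const _ hP,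
    G.lintegral_P h hh, one_mul, pointMean]
  exact (hP.mul (hw' true)).add (hP.mul_const _)

theorem lintegral_transLaw_next_label (G : MarkovGame S A B) {q : S → ℝ} {C : ℝ}
    (hq : IsNegativeSampling G.vol q C) (σ : JointPolicy S A B) {h : ℕ}
    (hh : h < G.H) {g : S × Bool → ℝ≥0∞} (hg : Measurable g) :
    ∫⁻ x, g (x.2.1, x.2.2.1) ∂(transLaw G q σ h) = ∫⁻ z, ∫⁻ s', ENNReal.ofReal (G.P h z s') *
      (2⁻¹ * (g (s', true) + g (s', false))) ∂G.vol ∂(G.tildeDist σ h) := by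
  have := hq.isProbabilityMeasure
  rw [lintegral_transLaw G q σ hh (g := fun x => g (x.2.1, x.2.2.1)) (hg.comp (by fun_prop))]
  refine lintegral_congr fun z => ?_
  have hP : Measurable (fun s' => ENNReal.ofReal (G.P h z s')) :=
    (measurable_ofReal_P G hh).comp measurable_prodMk_left
  have hm : Measurable (fun y : S × Bool × S =>
      ENNReal.ofReal (G.P h z y.1) * g (y.1, y.2.1)) :=
    (hP.comp measurable_fst).mul (hg.comp (by fun_prop))
  rw [lintegral_prod _ hm.aemeasurable]
  refine lintegral_congr fun s' => ?_
  have hs : Measurable (fun y : Bool × S => ENNReal.ofReal (G.P h z s') * g (s', y.1)) :=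
    hm.comp measurable_prodMk_left
  dsimp only
  rw [lintegral_prod _ hs.aemeasurable, lintegral_uniform_bool]
  simp only [lintegral_const, measure_univ, mul_one]
  ring

theorem lintegral_pairLaw_fst (G : MarkovGame S A B) {q : S → ℝ} {C : ℝ}
    (hq : IsNegativeSampling G.vol q C) (σ : JointPolicy S A B) {h : ℕ} (hh : h + 1 < G.H)
    {g : TransDraw S A B → ℝ≥0∞} (hg : Measurable g) :
    ∫⁻ x, g x.1 ∂(pairLaw G q σ h) = ∫⁻ x, g x ∂(transLaw G q σ h) := by
  have := hq.isProbabilityMeasure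
  rw [lintegral_pairLaw G q σ hh (g := fun x => g x.1) (hg.comp measurable_fst)]
  refine lintegral_congr fun x => ?_
  have hP : Measurable (fun y : (A × B) × S × S =>
      ENNReal.ofReal (G.P (h + 1) (x.2.1, y.1) y.2.1)) :=
    (measurable_ofReal_P G hh).comp (by fun_prop :
      Measurable (fun y : (A × B) × S × S => ((x.2.1, y.1), y.2.1)))
  dsimp only
  rw [lintegral_mul_const _ hP, lintegral_prod _ hP.aemeasurable]
  have e : ∀ c, ∫⁻ y, ENNReal.ofReal (G.P (h + 1) (x.2.1, c) y.1)
      ∂(G.vol.prod (G.vol.withDensity (fun s => ENNReal.ofReal (q s)))) = 1 := by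
    intro c
    rw [lintegral_prod _ (by exact (hP.comp measurable_prodMk_left).aemeasurable)]
    simp [G.lintegral_P (h + 1) hh]
  simp [e]

/-- The label of the second data point of an iteration is the label of the first one. As it is
independent of the state reached, the second point is labelled by a fair coin and its pair `z` has
the law `breveDist`. -/
theorem lintegral_pairLaw_brevePoint (G : MarkovGame S A B) {q : S → ℝ} {C : ℝ}
    (hq : IsNegativeSampling G.vol q C) (σ : JointPolicy S A B) {h : ℕ} (hh : h + 1 < G.H)
    {w : DataPoint S A B → ℝ≥0∞} (hw : Measurable w) :
    ∫⁻ x, w (PairDraw.brevePoint x) ∂(pairLaw G q σ h) =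
      ∫⁻ z, pointMean G q (h + 1) w z ∂(G.breveDist σ (h + 1)) := by
  have := hq.isProbabilityMeasure
  have hP := measurable_ofReal_P G hh
  have hq' : Measurable (fun s => ENNReal.ofReal (q s)) := hq.measurable.ennreal_ofReal
  have h1 : Measurable (fun x : (S × A × B) × S =>
      ENNReal.ofReal (G.P (h + 1) x.1 x.2) * w (x.1, x.2, true)) :=
    hP.mul (hw.comp (by fun_prop))
  have h0 : Measurable (fun x : (S × A × B) × S =>
      ENNReal.ofReal (q x.2) * w (x.1, x.2, false)) :=
    (hq'.comp measurable_snd).mul (hw.comp (by fun_prop))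
  have i1 := h1.lintegral_prod_right' (ν := G.vol)
  have i0 := h0.lintegral_prod_right' (ν := G.vol)
  have j1 : Measurable (fun s => ∫⁻ c, ∫⁻ s', ENNReal.ofReal (G.P (h + 1) (s, c) s') *
      w ((s, c), s', true) ∂G.vol ∂(unifActions A B)) := i1.lintegral_prod_right'
  have j0 : Measurable (fun s => ∫⁻ c, ∫⁻ s', ENNReal.ofReal (q s') *
      w ((s, c), s', false) ∂G.vol ∂(unifActions A B)) := i0.lintegral_prod_right'
  set g : S × Bool → ℝ≥0∞ := fun p => if p.2 then
      ∫⁻ c, ∫⁻ s', ENNReal.ofReal (G.P (h + 1) (p.1, c) s') *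
        w ((p.1, c), s', true) ∂G.vol ∂(unifActions A B)
    else ∫⁻ c, ∫⁻ s', ENNReal.ofReal (q s') * w ((p.1, c), s', false) ∂G.vol ∂(unifActions A B)
    with hg
  have hgm : Measurable g :=
    Measurable.ite (measurable_snd (measurableSet_singleton true)) (j1.comp measurable_fst)
      (j0.comp measurable_fst)
  have key : ∫⁻ x, w (PairDraw.brevePoint x) ∂(pairLaw G q σ h) =
      ∫⁻ x, g (x.2.1, x.2.2.1) ∂(transLaw G q σ h) := by
    rw [lintegral_pairLaw G q σ hh (g := fun x => w (PairDraw.brevePoint x))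
      (hw.comp measurable_brevePoint)]
    refine lintegral_congr fun x => ?_
    have hm : Measurable (fun y : (A × B) × S × S =>
        ENNReal.ofReal (G.P (h + 1) (x.2.1, y.1) y.2.1) * w (PairDraw.brevePoint (x, y))) :=
      (hP.comp (by fun_prop : Measurable (fun y : (A × B) × S × S => ((x.2.1, y.1), y.2.1)))).mul
        (hw.comp (measurable_brevePoint.comp measurable_prodMk_left))
    rw [lintegral_prod _ hm.aemeasurable]
    obtain ⟨z, s, b, sn⟩ := x
    have hPs : ∀ c, Measurable (fun s' => ENNReal.ofReal (G.P (h + 1) (s, c) s')) :=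
      fun c => hP.comp measurable_prodMk_left
    cases b with
    | true =>
      simp only [hg, if_true]
      refine lintegral_congr fun c => ?_
      rw [lintegral_prod _ (by exact (hm.comp measurable_prodMk_left).aemeasurable)]
      simp [PairDraw.brevePoint]
    | false =>
      simp only [hg, Bool.false_eq_true, if_false]
      refine lintegral_congr fun c => ?_
      rw [lintegral_prod _ (by exact (hm.comp measurable_prodMk_left).aemeasurable)]
      simp only [PairDraw.brevePoint, Bool.false_eq_true, if_false]
      have hw' : Measurable (fun s' => w ((s, c), s', false)) := hw.comp (by fun_prop)
      simp_rw [lintegral_const_mul _ hw']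
      rw [lintegral_mul_const _ (hPs c), G.lintegral_P (h + 1) hh, one_mul]
      exact lintegral_withDensity_eq_lintegral_mul _ hq' hw'
  rw [key, lintegral_transLaw_next_label G hq σ (by omega) hgm,
    lintegral_breveDist G σ hh (measurable_pointMean G hq.measurable hh hw)]
  refine lintegral_congr fun z => lintegral_congr fun s' => ?_
  congr 1
  simp only [hg, if_true, Bool.false_eq_true, if_false, pointMean]
  rw [lintegral_const_mul, lintegral_add_left]
  · exact i1.comp measurable_prodMk_left
  · exact (i1.comp measurable_prodMk_left).add (i0.comp measurable_prodMk_left)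

variable [MeasurableSingletonClass A] [MeasurableSingletonClass B]

theorem isProbabilityMeasure_transLaw (G : MarkovGame S A B) {q : S → ℝ} {C : ℝ}
    (hq : IsNegativeSampling G.vol q C) {σ : JointPolicy S A B} (hσ : IsPolicy G.H σ) {h : ℕ}
    (hh : h < G.H) : IsProbabilityMeasure (transLaw G q σ h) := by
  have := isProbabilityMeasure_tildeDist G hσ hh.le
  refine ⟨?_⟩
  rw [← lintegral_one, lintegral_transLaw_point G hq σ hh (w := fun _ => 1) measurable_const]
  simp [pointMean_one G hq hh]

theorem isProbabilityMeasure_pairLaw (G : MarkovGame S A B) {q : S → ℝ} {C : ℝ}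
    (hq : IsNegativeSampling G.vol q C) {σ : JointPolicy S A B} (hσ : IsPolicy G.H σ) {h : ℕ}
    (hh : h + 1 < G.H) : IsProbabilityMeasure (pairLaw G q σ h) := by
  have := isProbabilityMeasure_transLaw G hq hσ (h := h) (by omega)
  refine ⟨?_⟩
  rw [← lintegral_one, lintegral_pairLaw_fst G hq σ hh (g := fun _ => 1) measurable_const]
  simp

theorem isProbabilityMeasure_roundLaw (G : MarkovGame S A B) {q : S → ℝ} {C : ℝ}
    (hq : IsNegativeSampling G.vol q C) {σ : JointPolicy S A B} (hσ : IsPolicy G.H σ) :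
    IsProbabilityMeasure (roundLaw G q σ) := by
  have := G.H_pos
  have := fun h : Fin (G.H - 1) =>
    isProbabilityMeasure_pairLaw G hq hσ (h := h) (by have := h.2; omega)
  have := isProbabilityMeasure_transLaw G hq hσ (h := G.H - 1) (by omega)
  unfold roundLaw
  infer_instance

theorem measurable_transLaw {Ω' : Type*} {mΩ' : MeasurableSpace Ω'} (G : MarkovGame S A B) (q : S → ℝ)
    {σ : Ω' → JointPolicy S A B}
    (hσ : ∀ h < G.H, ∀ c : A × B, Measurable (fun x : Ω' × S => σ x.1 h x.2 c)) {h : ℕ}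
    (hh : h < G.H) {g : TransDraw S A B → ℝ≥0∞} (hg : Measurable g) :
    Measurable (fun ω => ∫⁻ x, g x ∂(transLaw G q (σ ω) h)) := by
  simp only [lintegral_transLaw G q _ hh hg]
  have hm : Measurable (fun x : TransDraw S A B => ENNReal.ofReal (G.P h x.1 x.2.1) * g x) :=
    ((measurable_ofReal_P G hh).comp
      (by fun_prop : Measurable (fun x : TransDraw S A B => (x.1, x.2.1)))).mul hg
  exact measurable_lintegral_tildeDist G hσ hh.le (hm.lintegral_prod_right'.comp measurable_snd)

theorem measurable_pairLaw {Ω' : Type*} {mΩ' : MeasurableSpace Ω'} (G : MarkovGame S A B) (q : S → ℝ)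
    {σ : Ω' → JointPolicy S A B}
    (hσ : ∀ h < G.H, ∀ c : A × B, Measurable (fun x : Ω' × S => σ x.1 h x.2 c)) {h : ℕ}
    (hh : h + 1 < G.H) {g : PairDraw S A B → ℝ≥0∞} (hg : Measurable g) :
    Measurable (fun ω => ∫⁻ x, g x ∂(pairLaw G q (σ ω) h)) := by
  simp only [lintegral_pairLaw G q _ hh hg]
  have hm : Measurable (fun x : PairDraw S A B =>
      ENNReal.ofReal (G.P (h + 1) (x.1.2.1, x.2.1) x.2.2.1) * g x) :=
    ((measurable_ofReal_P G hh).comp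
      (by fun_prop : Measurable (fun x : PairDraw S A B => ((x.1.2.1, x.2.1), x.2.2.1)))).mul hg
  exact measurable_transLaw G q hσ (by omega) hm.lintegral_prod_right'

/-- The sampling law of a round depends measurably on the past through the policy. -/
theorem measurable_roundLaw {Ω' : Type*} {mΩ' : MeasurableSpace Ω'} (G : MarkovGame S A B) {q : S → ℝ}
    {C : ℝ} (hq : IsNegativeSampling G.vol q C) {σ : Ω' → JointPolicy S A B}
    (hσ : ∀ h < G.H, ∀ c : A × B, Measurable (fun x : Ω' × S => σ x.1 h x.2 c))
    (hσ' : ∀ ω, IsPolicy G.H (σ ω)) : Measurable (fun ω => roundLaw G q (σ ω)) := by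
  have hH := G.H_pos
  have h1 := fun ω (h : Fin (G.H - 1)) =>
    isProbabilityMeasure_pairLaw G hq (hσ' ω) (h := h) (by have := h.2; omega)
  have h2 := fun ω => isProbabilityMeasure_transLaw G hq (hσ' ω) (h := G.H - 1) (by omega)
  have h3 := fun ω => isProbabilityMeasure_roundLaw G hq (hσ' ω)
  have hpi : Measurable (fun ω => Measure.pi (fun h : Fin (G.H - 1) => pairLaw G q (σ ω) h)) := by
    refine Measurable.measure_of_isPiSystem_of_isProbabilityMeasure generateFrom_pi.symm
      isPiSystem_pi ?_
    rintro _ ⟨t, ht, rfl⟩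
    have ht' : ∀ i, MeasurableSet (t i) := fun i => ht i trivial
    simp only [Measure.pi_pi]
    refine Finset.measurable_prod _ fun i _ => ?_
    simp only [← lintegral_indicator_one (ht' i)]
    exact measurable_pairLaw G q hσ (by have := i.2; omega) (measurable_one.indicator (ht' i))
  refine Measurable.measure_of_isPiSystem_of_isProbabilityMeasure generateFrom_prod.symm
    isPiSystem_prod ?_
  rintro _ ⟨s, (hs : MeasurableSet s), t, (ht : MeasurableSet t), rfl⟩
  simp only [roundLaw, Measure.prod_prod]
  refine ((Measure.measurable_coe hs).comp hpi).mul ?_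
  simp only [← lintegral_indicator_one ht]
  exact measurable_transLaw G q hσ (by omega) (measurable_one.indicator ht)

/-- The marginal law of the transition at step `h`, which is drawn inside the sampling loop if
`h < H - 1` and separately if `h = H - 1`. -/
theorem lintegral_roundLaw_tilde (G : MarkovGame S A B) {q : S → ℝ} {C : ℝ}
    (hq : IsNegativeSampling G.vol q C) {σ : JointPolicy S A B} (hσ : IsPolicy G.H σ) {h : ℕ}
    (hh : h < G.H) {g : TransDraw S A B → ℝ≥0∞} (hg : Measurable g) :
    ∫⁻ x, g (x.tilde h) ∂(roundLaw G q σ) = ∫⁻ x, g x ∂(transLaw G q σ h) := by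
  have h1 := fun h : Fin (G.H - 1) =>
    isProbabilityMeasure_pairLaw G hq hσ (h := h) (by have := h.2; omega)
  have h2 := isProbabilityMeasure_transLaw G hq hσ (h := G.H - 1) (by omega)
  unfold RoundDraw.tilde roundLaw
  split_ifs with h'
  · have hm : Measurable (fun x : PairDraw S A B => g x.1) := hg.comp measurable_fst
    rw [lintegral_prod _ (by fun_prop)]
    simp only [lintegral_const, measure_univ, mul_one]
    rw [(measurePreserving_eval (fun h : Fin (G.H - 1) => pairLaw G q σ h) ⟨h, h'⟩).lintegral_comp
      hm]
    exact lintegral_pairLaw_fst G hq σ (by omega) hg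
  · obtain rfl : h = G.H - 1 := by omega
    rw [lintegral_prod _ (by fun_prop)]
    simp

/-- The two data points of step `h + 1` come from different iterations of the sampling loop, hence
they are independent. -/
theorem lintegral_roundLaw_mul (G : MarkovGame S A B) {q : S → ℝ} {C : ℝ}
    (hq : IsNegativeSampling G.vol q C) {σ : JointPolicy S A B} (hσ : IsPolicy G.H σ) {h : ℕ}
    (hh : h < G.H - 1) {g : TransDraw S A B → ℝ≥0∞} (hg : Measurable g)
    {g' : PairDraw S A B → ℝ≥0∞} (hg' : Measurable g') :
    ∫⁻ x, g (x.tilde (h + 1)) * g' (x.1 ⟨h, hh⟩) ∂(roundLaw G q σ) =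
      (∫⁻ x, g x ∂(transLaw G q σ (h + 1))) * ∫⁻ x, g' x ∂(pairLaw G q σ h) := by
  have h1 := fun h : Fin (G.H - 1) =>
    isProbabilityMeasure_pairLaw G hq hσ (h := h) (by have := h.2; omega)
  have h2 := isProbabilityMeasure_transLaw G hq hσ (h := G.H - 1) (by omega)
  have me := fun i : Fin (G.H - 1) =>
    measurePreserving_eval (fun h : Fin (G.H - 1) => pairLaw G q σ h) i
  unfold RoundDraw.tilde roundLaw
  split_ifs with h'
  · have hm : Measurable (fun x : PairDraw S A B => g x.1) := hg.comp measurable_fst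
    rw [lintegral_prod _ (by fun_prop)]
    simp only [lintegral_const, measure_univ, mul_one]
    have hind : ProbabilityTheory.iIndepFun
        (fun (i : Fin (G.H - 1)) (x : Fin (G.H - 1) → PairDraw S A B) => x i)
        (Measure.pi (fun h : Fin (G.H - 1) => pairLaw G q σ h)) :=
      ProbabilityTheory.iIndepFun_pi (X := fun _ x => x) (fun _ => aemeasurable_id)
    have hne : (⟨h + 1, h'⟩ : Fin (G.H - 1)) ≠ ⟨h, hh⟩ := by
      intro e; simp at e
    have hi := (hind.indepFun hne).comp hm hg'
    have := ProbabilityTheory.lintegral_mul_eq_lintegral_mul_lintegral_of_indepFun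
      (hm.comp (measurable_pi_apply _)) (hg'.comp (measurable_pi_apply _)) hi
    refine Eq.trans this ?_
    congr 1
    · exact ((me ⟨h + 1, h'⟩).lintegral_comp hm).trans
        (lintegral_pairLaw_fst G hq σ (by simpa using (by omega : h + 1 + 1 < G.H)) hg)
    · exact (me ⟨h, hh⟩).lintegral_comp hg'
  · have e : h + 1 = G.H - 1 := by omega
    have hm : Measurable (fun x : Fin (G.H - 1) → PairDraw S A B => g' (x ⟨h, hh⟩)) := by fun_prop
    rw [lintegral_prod_symm' _ (by fun_prop)]
    simp_rw [lintegral_const_mul _ hm]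
    rw [lintegral_mul_const _ hg, e]
    congr 1
    exact (me ⟨h, hh⟩).lintegral_comp hg'

theorem lintegral_roundWeight_zero (G : MarkovGame S A B) {q : S → ℝ} {C : ℝ}
    (hq : IsNegativeSampling G.vol q C) {σ : JointPolicy S A B} (hσ : IsPolicy G.H σ)
    {w : DataPoint S A B → ℝ≥0∞} (hw : Measurable w) :
    ∫⁻ x, roundWeight w 0 x ∂(roundLaw G q σ) =
      ∫⁻ z, pointMean G q 0 w z ∂(G.tildeDist σ 0) := by
  have e : ∀ x : RoundDraw S A B G.H,
      roundWeight w 0 x = w (TransDraw.point (x.tilde 0)) := fun x => by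
    simp [roundWeight, RoundDraw.points]
  simp only [e]
  rw [← lintegral_transLaw_point G hq σ G.H_pos hw]
  exact lintegral_roundLaw_tilde G hq hσ G.H_pos (hw.comp measurable_point)

theorem lintegral_roundWeight_succ (G : MarkovGame S A B) {q : S → ℝ} {C : ℝ}
    (hq : IsNegativeSampling G.vol q C) {σ : JointPolicy S A B} (hσ : IsPolicy G.H σ) {h : ℕ}
    (hh : h + 1 < G.H) {w : DataPoint S A B → ℝ≥0∞} (hw : Measurable w) :
    ∫⁻ x, roundWeight w (h + 1) x ∂(roundLaw G q σ) =
      (∫⁻ z, pointMean G q (h + 1) w z ∂(G.tildeDist σ (h + 1))) *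
        ∫⁻ z, pointMean G q (h + 1) w z ∂(G.breveDist σ (h + 1)) := by
  have h' : h < G.H - 1 := by omega
  have e : ∀ x : RoundDraw S A B G.H, roundWeight w (h + 1) x =
      w (TransDraw.point (x.tilde (h + 1))) * w (PairDraw.brevePoint (x.1 ⟨h, h'⟩)) := fun x => by
    simp [roundWeight, RoundDraw.points, h']
  simp only [e]
  rw [← lintegral_transLaw_point G hq σ hh hw, ← lintegral_pairLaw_brevePoint G hq σ hh hw]
  exact lintegral_roundLaw_mul G hq hσ h' (hw.comp measurable_point)
    (hw.comp measurable_brevePoint)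

end RoundLaw

/-! ### The likelihood ratio of the contrastive labels -/

/-- The probability of the label `y` when the density ratio is `f`. -/
noncomputable def labelProb (f : ℝ) (y : Bool) : ℝ := if y then f / (1 + f) else 1 / (1 + f)

theorem labelProb_nonneg {f : ℝ} (hf : 0 ≤ f) (y : Bool) : 0 ≤ labelProb f y := by
  unfold labelProb; split_ifs <;> positivity

theorem pointLoss_eq {f : ℝ} (hf : 0 ≤ f) {y : Bool} (h : labelProb f y ≠ 0) :
    pointLoss f y = ENNReal.ofReal (-Real.log (labelProb f y)) := by
  cases y with
  | true =>
    have h0 : f ≠ 0 := by rintro rfl; simp [labelProb] at h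
    have : 0 < f := lt_of_le_of_ne hf h0.symm
    simp only [pointLoss, labelProb, if_true, h0, if_false]
    rw [← Real.log_inv]
    congr 2
    field_simp
    ring
  | false =>
    simp only [pointLoss, labelProb, Bool.false_eq_true, if_false]
    rw [← Real.log_inv]
    simp

theorem labelProb_le_one {f : ℝ} (hf : 0 ≤ f) (y : Bool) : labelProb f y ≤ 1 := by
  unfold labelProb; split_ifs <;> rw [div_le_one (by positivity)] <;> linarith

theorem labelProb_ne_zero_of_pointLoss {f : ℝ} (hf : 0 ≤ f) {y : Bool} (h : pointLoss f y ≠ ⊤) :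
    labelProb f y ≠ 0 := by
  cases y with
  | true =>
    have h0 : f ≠ 0 := by rintro rfl; simp [pointLoss] at h
    have : 0 < f := lt_of_le_of_ne hf h0.symm
    simp only [labelProb, if_true]; positivity
  | false => simp only [labelProb, Bool.false_eq_true, if_false]; positivity

/-- The loss is the negative log-likelihood of the labels. -/
theorem exp_neg_sum_pointLoss {α : Type*} (D : List α) {f : α → ℝ} {y : α → Bool}
    (hf : ∀ x ∈ D, 0 ≤ f x) (h : (D.map (fun x => pointLoss (f x) (y x))).sum ≠ ⊤) :
    Real.exp (-((D.map (fun x => pointLoss (f x) (y x))).sum).toReal) =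
      (D.map (fun x => labelProb (f x) (y x))).prod := by
  induction D with
  | nil => simp
  | cons a D ih =>
    simp only [List.map_cons, List.sum_cons, List.prod_cons, ne_eq, ENNReal.add_eq_top,
      not_or] at h ⊢
    have h0 := hf a (by simp)
    have hp := labelProb_ne_zero_of_pointLoss h0 h.1
    have hp' := lt_of_le_of_ne (labelProb_nonneg h0 (y a)) hp.symm
    rw [ENNReal.toReal_add h.1 h.2, neg_add, Real.exp_add,
      ih (fun x hx => hf x (by simp [hx])) h.2, pointLoss_eq h0 hp, ENNReal.toReal_ofReal, neg_neg,
      Real.exp_log hp']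
    have := Real.log_nonpos hp'.le (labelProb_le_one h0 _)
    linarith

/-- The square root of the likelihood ratio of the label `y` for the density ratios `f` and `g`. -/
noncomputable def sqrtRatio (f g : ℝ) (y : Bool) : ℝ≥0∞ :=
  ENNReal.ofReal √(labelProb f y / labelProb g y)

/-- A candidate whose empirical loss is at most that of the truth has likelihood ratio at least
one. -/
theorem one_le_prod_sqrtRatio {α : Type*} (D : List α) {f g : α → ℝ} {y : α → Bool}
    (hf : ∀ x ∈ D, 0 ≤ f x) (hg : ∀ x ∈ D, 0 ≤ g x)
    (hpos : ∀ x ∈ D, labelProb (g x) (y x) ≠ 0)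
    (hle : (D.map (fun x => pointLoss (f x) (y x))).sum ≤
      (D.map (fun x => pointLoss (g x) (y x))).sum) :
    1 ≤ (D.map (fun x => sqrtRatio (f x) (g x) (y x))).prod := by
  have htop : (D.map (fun x => pointLoss (g x) (y x))).sum ≠ ⊤ := by
    clear hle
    induction D with
    | nil => simp
    | cons a D ih =>
      simp only [List.map_cons, List.sum_cons, ne_eq, ENNReal.add_eq_top, not_or]
      refine ⟨?_, ih (fun x hx => hf x (by simp [hx])) (fun x hx => hg x (by simp [hx]))
        (fun x hx => hpos x (by simp [hx]))⟩
      rw [pointLoss_eq (hg a (by simp)) (hpos a (by simp))]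
      exact ENNReal.ofReal_ne_top
  have htop' := ne_top_of_le_ne_top htop hle
  have e1 := exp_neg_sum_pointLoss D hf htop'
  have e2 := exp_neg_sum_pointLoss D hg htop
  have hle' : (D.map (fun x => labelProb (g x) (y x))).prod ≤
      (D.map (fun x => labelProb (f x) (y x))).prod := by
    rw [← e1, ← e2, Real.exp_le_exp, neg_le_neg_iff]
    exact ENNReal.toReal_mono htop hle
  have hgp : 0 < (D.map (fun x => labelProb (g x) (y x))).prod := e2 ▸ Real.exp_pos _
  have key : (D.map (fun x => sqrtRatio (f x) (g x) (y x))).prod = ENNReal.ofReal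
      √((D.map (fun x => labelProb (f x) (y x))).prod /
        (D.map (fun x => labelProb (g x) (y x))).prod) := by
    clear hle htop htop' e1 e2 hle' hgp
    induction D with
    | nil => simp
    | cons a D ih =>
      simp only [List.map_cons, List.prod_cons]
      rw [ih (fun x hx => hf x (by simp [hx])) (fun x hx => hg x (by simp [hx]))
        (fun x hx => hpos x (by simp [hx])), mul_div_mul_comm, Real.sqrt_mul, sqrtRatio,
        ENNReal.ofReal_mul (Real.sqrt_nonneg _)]
      exact div_nonneg (labelProb_nonneg (hf a (by simp)) _) (labelProb_nonneg (hg a (by simp)) _)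
  rw [key, ENNReal.one_le_ofReal, Real.one_le_sqrt, one_le_div hgp]
  exact hle'

/-! ### Hellinger affinity and total variation -/

/-- The density of the affinity between the laws of a labelled point under the ratios `f` and `g`,
with respect to the negative sampling law; here `g` is the true ratio. -/
noncomputable def affDensity (f g : ℝ) : ℝ :=
  (g * √(labelProb f true / labelProb g true) + √(labelProb f false / labelProb g false)) / 2

theorem affDensity_eq {f g : ℝ} (hf : 0 ≤ f) (hg : 0 ≤ g) :
    affDensity f g = (1 + √f * √g) * √(1 + g) / (2 * √(1 + f)) := by
  have hf' : 0 < √(1 + f) := Real.sqrt_pos.2 (by linarith)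
  have hg' : 0 < √(1 + g) := Real.sqrt_pos.2 (by linarith)
  simp only [affDensity, labelProb, if_true, Bool.false_eq_true, if_false]
  rw [Real.sqrt_div (by positivity), Real.sqrt_div hf, Real.sqrt_div hg,
    Real.sqrt_div (by positivity), Real.sqrt_div zero_le_one, Real.sqrt_div zero_le_one]
  rcases hg.eq_or_lt with rfl | hg0
  · simp only [Real.sqrt_zero, zero_mul, mul_zero, Real.sqrt_one]
    field_simp
    ring
  · have hs : 0 < √g := Real.sqrt_pos.2 hg0
    have e : g = √g * √g := (Real.mul_self_sqrt hg).symm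
    nth_rewrite 1 [e]
    simp only [Real.sqrt_one]
    field_simp
    ring

theorem affDensity_nonneg {f g : ℝ} (hf : 0 ≤ f) (hg : 0 ≤ g) : 0 ≤ affDensity f g := by
  rw [affDensity_eq hf hg]; positivity

/-- Write `f = tan² α` and `g = tan² β`; up to the factor `(1 + g) / 2` the right-hand side is
`1 - cos (α - β)`, which is at least `sin² (α - β) / 2`. -/
theorem sq_sub_sqrt_le_sub_affDensity {f g M : ℝ} (hf : 0 ≤ f) (hg : 0 ≤ g) (hM : f ≤ M) :
    (√f - √g) ^ 2 / (4 * (1 + M)) ≤ (1 + g) / 2 - affDensity f g := by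
  rw [affDensity_eq hf hg]
  have hf' : 0 < √(1 + f) := Real.sqrt_pos.2 (by linarith)
  have hg' : 0 < √(1 + g) := Real.sqrt_pos.2 (by linarith)
  have e1 : √(1 + f) ^ 2 = 1 + f := Real.sq_sqrt (by linarith)
  have e2 : √(1 + g) ^ 2 = 1 + g := Real.sq_sqrt (by linarith)
  have e3 : √f ^ 2 = f := Real.sq_sqrt hf
  have e4 : √g ^ 2 = g := Real.sq_sqrt hg
  have e : (√f - √g) ^ 2 = (√(1 + f) * √(1 + g)) ^ 2 - (1 + √f * √g) ^ 2 := by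
    rw [mul_pow, e1, e2]; linear_combination (1 + √g ^ 2) * e3 + (1 + f) * e4
  calc (√f - √g) ^ 2 / (4 * (1 + M)) ≤ (√f - √g) ^ 2 / (4 * (1 + f)) := by gcongr
    _ = ((√(1 + f) * √(1 + g)) ^ 2 - (1 + √f * √g) ^ 2) / (4 * √(1 + f) ^ 2) := by rw [e, e1]
    _ ≤ √(1 + g) ^ 2 / 2 - (1 + √f * √g) * √(1 + g) / (2 * √(1 + f)) := by
      rw [← sub_nonneg]
      have : √(1 + g) ^ 2 / 2 - (1 + √f * √g) * √(1 + g) / (2 * √(1 + f)) -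
          ((√(1 + f) * √(1 + g)) ^ 2 - (1 + √f * √g) ^ 2) / (4 * √(1 + f) ^ 2) =
          (√(1 + f) * √(1 + g) - (1 + √f * √g)) ^ 2 / (4 * √(1 + f) ^ 2) := by
        generalize √(1 + f) = p at *
        field_simp
        ring
      rw [this]
      positivity
    _ = _ := by rw [e2]

theorem affDensity_le {f g : ℝ} (hf : 0 ≤ f) (hg : 0 ≤ g) : affDensity f g ≤ (1 + g) / 2 := by
  have h1 := sq_sub_sqrt_le_sub_affDensity hf hg le_rfl
  have h2 : 0 ≤ (√f - √g) ^ 2 / (4 * (1 + f)) := by positivity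
  linarith

theorem lintegral_one_add_div_two {X : Type*} [MeasurableSpace X] {ν : Measure X}
    [IsProbabilityMeasure ν] {g : X → ℝ} (hg : ∀ x, 0 ≤ g x)
    (hg1 : ∫⁻ x, ENNReal.ofReal (g x) ∂ν = 1) : ∫⁻ x, ENNReal.ofReal ((1 + g x) / 2) ∂ν = 1 := by
  have e : ∀ x, ENNReal.ofReal ((1 + g x) / 2) = 2⁻¹ * (1 + ENNReal.ofReal (g x)) := fun x => by
    rw [div_eq_inv_mul, ENNReal.ofReal_mul (by norm_num), ENNReal.ofReal_add zero_le_one (hg x),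
      ENNReal.ofReal_inv_of_pos two_pos]
    simp
  simp only [e]
  rw [lintegral_const_mul' _ _ (by simp), lintegral_add_left measurable_const, hg1]
  simp only [lintegral_const, measure_univ, mul_one, one_add_one_eq_two]
  exact ENNReal.inv_mul_cancel (by simp) (by simp)

/-- The Cauchy-Schwarz inequality. -/
theorem sq_integral_mul_le {X : Type*} [MeasurableSpace X] {ν : Measure X} {u v : X → ℝ}
    (hu : Integrable (fun x => u x ^ 2) ν) (huv : Integrable (fun x => u x * v x) ν)
    (hv : Integrable (fun x => v x ^ 2) ν) :
    (∫ x, u x * v x ∂ν) ^ 2 ≤ (∫ x, u x ^ 2 ∂ν) * ∫ x, v x ^ 2 ∂ν := by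
  have h : ∀ t : ℝ, 0 ≤ (∫ x, u x ^ 2 ∂ν) * (t * t) + (-2 * ∫ x, u x * v x ∂ν) * t +
      ∫ x, v x ^ 2 ∂ν := by
    intro t
    have e : ∫ x, (t * u x - v x) ^ 2 ∂ν = (∫ x, u x ^ 2 ∂ν) * (t * t) +
        (-2 * ∫ x, u x * v x ∂ν) * t + ∫ x, v x ^ 2 ∂ν := by
      have : ∀ x, (t * u x - v x) ^ 2 = (t * t) * u x ^ 2 + (-2 * t) * (u x * v x) + v x ^ 2 :=
        fun x => by ring
      simp only [this]
      rw [integral_add (by exact (hu.const_mul _).add (huv.const_mul _)) hv,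
        integral_add (hu.const_mul _) (huv.const_mul _), integral_const_mul, integral_const_mul]
      ring
    rw [← e]
    exact integral_nonneg fun x => sq_nonneg _
  have := discrim_le_zero h
  rw [discrim] at this
  linarith

/-- The total variation distance between a probability density and the normalization of a
nonnegative function is controlled by the Hellinger distance before normalization. The inverse of
`∫ f` is zero if `f` vanishes almost everywhere. -/
theorem sq_integral_abs_sub_normalized_le {X : Type*} [MeasurableSpace X] {ν : Measure X}
    [IsProbabilityMeasure ν] {f g : X → ℝ} (hfm : Measurable f) (hgm : Measurable g) {M : ℝ}
    (hf : ∀ x, 0 ≤ f x) (hfM : ∀ x, f x ≤ M) (hg : ∀ x, 0 ≤ g x) (hgM : ∀ x, g x ≤ M)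
    (hg1 : ∫ x, g x ∂ν = 1) :
    (∫ x, |g x - f x * (∫ y, f y ∂ν)⁻¹| ∂ν) ^ 2 ≤ 4 * ∫ x, (√(f x) - √(g x)) ^ 2 ∂ν := by
  set Z := ∫ y, f y ∂ν with hZ
  have ib : ∀ {k : X → ℝ}, Measurable k → ∀ c : ℝ, (∀ x, |k x| ≤ c) → Integrable k ν :=
    fun hk c hc => Integrable.of_bound hk.aestronglyMeasurable c (Filter.Eventually.of_forall hc)
  have hif : Integrable f ν := ib hfm M fun x => by rw [abs_of_nonneg (hf x)]; exact hfM x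
  have hig : Integrable g ν := ib hgm M fun x => by rw [abs_of_nonneg (hg x)]; exact hgM x
  have him : Integrable (fun x => √(f x) * √(g x)) ν := by
    refine ib (by fun_prop) (√M * √M) fun x => ?_
    rw [abs_of_nonneg (by positivity)]
    have := Real.sqrt_le_sqrt (hfM x)
    have := Real.sqrt_le_sqrt (hgM x)
    gcongr
  have sf : ∀ x, √(f x) ^ 2 = f x := fun x => Real.sq_sqrt (hf x)
  have sg : ∀ x, √(g x) ^ 2 = g x := fun x => Real.sq_sqrt (hg x)
  set W := ∫ x, √(f x) * √(g x) ∂ν with hW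
  -- the square of `c √f + √g` for any constant `c`
  have esq : ∀ c : ℝ, ∫ x, (c * √(f x) + √(g x)) ^ 2 ∂ν = c ^ 2 * Z + 2 * c * W + 1 := by
    intro c
    have : ∀ x, (c * √(f x) + √(g x)) ^ 2 = c ^ 2 * f x + 2 * c * (√(f x) * √(g x)) + g x :=
      fun x => by linear_combination c ^ 2 * sf x + sg x
    simp only [this]
    rw [integral_add (by exact (hif.const_mul _).add (him.const_mul _)) hig,
      integral_add (hif.const_mul _) (him.const_mul _), integral_const_mul, integral_const_mul, hg1]
  have isq : ∀ c : ℝ, Integrable (fun x => (c * √(f x) + √(g x)) ^ 2) ν := by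
    intro c
    have : ∀ x, (c * √(f x) + √(g x)) ^ 2 = c ^ 2 * f x + 2 * c * (√(f x) * √(g x)) + g x :=
      fun x => by linear_combination c ^ 2 * sf x + sg x
    simp only [this]
    exact ((hif.const_mul _).add (him.const_mul _)).add hig
  have eW : ∫ x, (√(f x) - √(g x)) ^ 2 ∂ν = Z - 2 * W + 1 := by
    have := esq (-1)
    rw [show ∫ x, (√(f x) - √(g x)) ^ 2 ∂ν = ∫ x, (-1 * √(f x) + √(g x)) ^ 2 ∂ν from
      integral_congr_ae (Filter.Eventually.of_forall fun x => by ring), this]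
    ring
  rw [eW]
  have hZ0 : 0 ≤ Z := integral_nonneg hf
  have hWZ : W ^ 2 ≤ Z := by
    have := sq_integral_mul_le (ν := ν) (u := fun x => √(f x)) (v := fun x => √(g x))
      (by simpa only [sf] using hif) him (by simpa only [sg] using hig)
    simpa only [sf, sg, hg1, mul_one] using this
  rcases hZ0.eq_or_lt with h0 | hpos
  · have hW0 : W = 0 := by
      rw [← h0] at hWZ; exact pow_eq_zero_iff (two_ne_zero) |>.1 (le_antisymm hWZ (sq_nonneg _))
    have : ∫ x, |g x - f x * Z⁻¹| ∂ν = 1 := by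
      rw [← h0, ← hg1]
      exact integral_congr_ae (Filter.Eventually.of_forall fun x => by simp [abs_of_nonneg (hg x)])
    rw [this, hW0, ← h0]; norm_num
  · set c := √(Z⁻¹) with hc
    have hcZ : c ^ 2 = Z⁻¹ := Real.sq_sqrt (by positivity)
    have hcZ1 : c ^ 2 * Z = 1 := by rw [hcZ, inv_mul_cancel₀ hpos.ne']
    have hc0 : 0 ≤ c := Real.sqrt_nonneg _
    have e1 : ∀ x, |g x - f x * Z⁻¹| = |-c * √(f x) + √(g x)| * (c * √(f x) + √(g x)) := by
      intro x
      have h2 : 0 ≤ c * √(f x) + √(g x) := by positivity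
      nth_rewrite 1 [← abs_of_nonneg h2]
      rw [← abs_mul, ← hcZ]
      congr 1
      linear_combination c ^ 2 * sf x - sg x
    have hi : Integrable (fun x => |-c * √(f x) + √(g x)| * (c * √(f x) + √(g x))) ν := by
      simp only [← e1]
      exact (hig.sub (hif.mul_const _)).abs
    have := sq_integral_mul_le (ν := ν) (u := fun x => |-c * √(f x) + √(g x)|)
      (v := fun x => c * √(f x) + √(g x)) (by simpa only [sq_abs] using isq (-c)) hi (isq c)
    simp only [sq_abs, esq, ← e1] at this
    refine this.trans ?_
    have h4 : (-c) ^ 2 * Z + 2 * -c * W + 1 = 2 - 2 * (c * W) := by linear_combination hcZ1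
    have h5 : c ^ 2 * Z + 2 * c * W + 1 = 2 + 2 * (c * W) := by linear_combination hcZ1
    rw [h4, h5]
    -- the difference of both sides is `4 (√Z - W / √Z)²`
    have h6 : (Z * c - W * c) ^ 2 = Z - 2 * W + (c * W) ^ 2 := by
      linear_combination (Z - 2 * W) * hcZ1
    nlinarith [sq_nonneg (Z * c - W * c)]

theorem measurable_labelProb (y : Bool) : Measurable (fun f => labelProb f y) := by
  cases y <;> simp only [labelProb, if_true, Bool.false_eq_true, if_false] <;> fun_prop

theorem sq_lintegral_abs_sub_normalized_le {X : Type*} [MeasurableSpace X] {ν : Measure X}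
    [IsProbabilityMeasure ν] {f g : X → ℝ} (hfm : Measurable f) (hgm : Measurable g) {M : ℝ}
    (hf : ∀ x, 0 ≤ f x) (hfM : ∀ x, f x ≤ M) (hg : ∀ x, 0 ≤ g x) (hgM : ∀ x, g x ≤ M)
    (hg1 : ∫ x, g x ∂ν = 1) (hM : 0 ≤ M) :
    (∫⁻ x, ENNReal.ofReal |g x - f x * (∫ y, f y ∂ν)⁻¹| ∂ν) ^ 2 ≤ ENNReal.ofReal (16 * (1 + M)) *
      (1 - ∫⁻ x, ENNReal.ofReal (affDensity (f x) (g x)) ∂ν) := by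
  have hif : Integrable f ν := Integrable.of_bound hfm.aestronglyMeasurable M
    (Filter.Eventually.of_forall fun x => by
      rw [Real.norm_eq_abs, abs_of_nonneg (hf x)]; exact hfM x)
  have hig : Integrable g ν := Integrable.of_bound hgm.aestronglyMeasurable M
    (Filter.Eventually.of_forall fun x => by
      rw [Real.norm_eq_abs, abs_of_nonneg (hg x)]; exact hgM x)
  have hisq : Integrable (fun x => (√(f x) - √(g x)) ^ 2) ν := by
    refine Integrable.mono' (hif.add hig) (by fun_prop) (Filter.Eventually.of_forall fun x => ?_)
    rw [Real.norm_eq_abs, abs_of_nonneg (sq_nonneg _), Pi.add_apply]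
    nlinarith [Real.sq_sqrt (hf x), Real.sq_sqrt (hg x),
      mul_nonneg (Real.sqrt_nonneg (f x)) (Real.sqrt_nonneg (g x))]
  have key := sq_integral_abs_sub_normalized_le hfm hgm hf hfM hg hgM hg1
  have e1 : ∫⁻ x, ENNReal.ofReal |g x - f x * (∫ y, f y ∂ν)⁻¹| ∂ν =
      ENNReal.ofReal (∫ x, |g x - f x * (∫ y, f y ∂ν)⁻¹| ∂ν) :=
    (ofReal_integral_eq_lintegral_ofReal (hig.sub (hif.mul_const _)).abs
      (Filter.Eventually.of_forall fun x => abs_nonneg _)).symm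
  have e2 : ENNReal.ofReal (∫ x, (√(f x) - √(g x)) ^ 2 / (4 * (1 + M)) ∂ν) =
      ∫⁻ x, ENNReal.ofReal ((√(f x) - √(g x)) ^ 2 / (4 * (1 + M))) ∂ν :=
    ofReal_integral_eq_lintegral_ofReal (hisq.div_const _)
      (Filter.Eventually.of_forall fun x => by positivity)
  have e3 : ∫⁻ x, ENNReal.ofReal ((1 + g x) / 2) ∂ν = 1 := by
    refine lintegral_one_add_div_two hg ?_
    rw [← ofReal_integral_eq_lintegral_ofReal hig (Filter.Eventually.of_forall hg), hg1,
      ENNReal.ofReal_one]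
  have hsum : ∫⁻ x, ENNReal.ofReal ((√(f x) - √(g x)) ^ 2 / (4 * (1 + M))) ∂ν +
      ∫⁻ x, ENNReal.ofReal (affDensity (f x) (g x)) ∂ν ≤ 1 := by
    rw [← lintegral_add_left (by fun_prop), ← e3]
    refine lintegral_mono fun x => ?_
    rw [← ENNReal.ofReal_add (by positivity) (affDensity_nonneg (hf x) (hg x))]
    refine ENNReal.ofReal_le_ofReal ?_
    linarith [sq_sub_sqrt_le_sub_affDensity (hf x) (hg x) (hfM x)]
  have hne : ∫⁻ x, ENNReal.ofReal (affDensity (f x) (g x)) ∂ν ≠ ⊤ :=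
    ne_top_of_le_ne_top ENNReal.one_ne_top (le_add_self.trans hsum)
  have h1 := ENNReal.le_sub_of_add_le_right hne hsum
  refine le_trans ?_ (mul_le_mul_right h1 _)
  rw [e1, ← e2, ← ENNReal.ofReal_pow (integral_nonneg fun x => abs_nonneg _),
    ← ENNReal.ofReal_mul (by positivity)]
  refine ENNReal.ofReal_le_ofReal (key.trans (le_of_eq ?_))
  rw [integral_div]
  field_simp
  ring

/-! ### The exponential supermartingale of a weight -/

/-- The inequality `1 - u ≤ exp (-u)`, in the form that makes a weight of mean `1 - u` into a
supermartingale increment. -/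
theorem ofReal_exp_mul_le_one {x u : ℝ≥0∞} (h : x + u = 1) :
    ENNReal.ofReal (Real.exp u.toReal) * x ≤ 1 := by
  have hx : x ≠ ⊤ := by rintro rfl; simp at h
  have hu : u ≠ ⊤ := by rintro rfl; simp at h
  have e : x.toReal + u.toReal = 1 := by rw [← ENNReal.toReal_add hx hu, h, ENNReal.toReal_one]
  rw [← ENNReal.ofReal_toReal hx, ← ENNReal.ofReal_mul (Real.exp_nonneg _),
    ENNReal.ofReal_le_one]
  have h1 : x.toReal ≤ Real.exp (-u.toReal) := by linarith [Real.add_one_le_exp (-u.toReal)]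
  calc Real.exp u.toReal * x.toReal ≤ Real.exp u.toReal * Real.exp (-u.toReal) := by gcongr
    _ = 1 := by rw [← Real.exp_add, add_neg_cancel, Real.exp_zero]

theorem lintegral_add_lintegral_one_sub {X : Type*} [MeasurableSpace X] (m : Measure X)
    [IsProbabilityMeasure m] {a : X → ℝ≥0∞} (ha : Measurable a) (h1 : ∀ x, a x ≤ 1) :
    ∫⁻ x, a x ∂m + ∫⁻ x, (1 - a x) ∂m = 1 := by
  rw [← lintegral_add_left ha]
  simp [add_tsub_cancel_of_le (h1 _)]

section Supermartingale

variable {S A B Ω : Type*} [MeasurableSpace S]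
  [Fintype A] [Nonempty A] [MeasurableSpace A] [Fintype B] [Nonempty B] [MeasurableSpace B]

/-- The expected loss of mass of the weight `w` over the points of one round: the mean of
`1 - pointMean` under the laws of the pairs `z` of these points. -/
noncomputable def roundGap (G : MarkovGame S A B) (q : S → ℝ) (w : DataPoint S A B → ℝ≥0∞) (h : ℕ)
    (σ : JointPolicy S A B) : ℝ≥0∞ :=
  ∫⁻ z, (1 - pointMean G q h w z) ∂(G.tildeDist σ h) +
    if 1 ≤ h then ∫⁻ z, (1 - pointMean G q h w z) ∂(G.breveDist σ h) else 0

variable [mΩ : MeasurableSpace Ω] {μ : Measure Ω} {d : ℕ} {G : MarkovGame S A B} {q : S → ℝ}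
  {Ψ : Finset (S → Feat d)} {Φ : Finset (S × A × B → Feat d)} {lam gam iota : ℕ → ℝ} {K : ℕ}

namespace ContrastiveULCB

theorem isPolicy (R : ContrastiveULCB μ G q Ψ Φ lam gam iota K) {k : ℕ} (hk : k ≤ K) (ω : Ω) :
    IsPolicy G.H (R.σ k ω) := by
  refine ⟨fun h hh c => (R.measurable_σ k hk h hh c).comp
    (@measurable_prodMk_left _ _ (R.𝓕 k) _ ω), ?_, ?_⟩
  · intro h hh s c
    rcases Nat.eq_zero_or_pos k with rfl | hk'
    · rw [R.init ω h hh]; positivity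
    · exact (R.cce k hk' hk h hh ω s).nonneg c
  · intro h hh s
    rcases Nat.eq_zero_or_pos k with rfl | hk'
    · simp only [R.init ω h hh]
      simp
      field_simp
    · exact (R.cce k hk' hk h hh ω s).sum_eq_one

/-- The product of the weights of the data of step `h` after `n` rounds, compensated by the exponential
of the gaps of these rounds. -/
noncomputable def compensatedWeight (R : ContrastiveULCB μ G q Ψ Φ lam gam iota K)
    (w : DataPoint S A B → ℝ≥0∞) (h n : ℕ) (ω : Ω) : ℝ≥0∞ :=
  ((dataset (fun τ => R.X τ ω) h n).map w).prod *
    ENNReal.ofReal (Real.exp (∑ i ∈ Finset.range n, (roundGap G q w h (R.σ i ω)).toReal))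

theorem compensatedWeight_succ (R : ContrastiveULCB μ G q Ψ Φ lam gam iota K)
    (w : DataPoint S A B → ℝ≥0∞) (h n : ℕ) (ω : Ω) :
    R.compensatedWeight w h (n + 1) ω = R.compensatedWeight w h n ω *
      ENNReal.ofReal (Real.exp (roundGap G q w h (R.σ n ω)).toReal) *
        roundWeight w h (R.X (n + 1) ω) := by
  simp only [compensatedWeight, dataset, List.map_append, List.prod_append, Finset.sum_range_succ,
    Real.exp_add, roundWeight]
  rw [ENNReal.ofReal_mul (Real.exp_nonneg _)]
  ring

end ContrastiveULCB

variable [MeasurableSingletonClass A] [MeasurableSingletonClass B]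

theorem roundGap_ne_top (G : MarkovGame S A B) (q : S → ℝ) (w : DataPoint S A B → ℝ≥0∞)
    {σ : JointPolicy S A B} (hσ : IsPolicy G.H σ) {h : ℕ} (hh : h < G.H) :
    roundGap G q w h σ ≠ ⊤ := by
  have := isProbabilityMeasure_tildeDist G hσ hh.le
  have := isProbabilityMeasure_breveDist G hσ hh
  have key : ∀ m : Measure (S × A × B), IsProbabilityMeasure m →
      ∫⁻ z, (1 - pointMean G q h w z) ∂m ≠ ⊤ := fun m hm => by
    refine ne_top_of_le_ne_top ENNReal.one_ne_top
      ((lintegral_mono fun z => tsub_le_self).trans (le_of_eq ?_))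
    simp
  unfold roundGap
  split_ifs
  · exact ENNReal.add_ne_top.2 ⟨key _ inferInstance, key _ inferInstance⟩
  · simpa using key _ inferInstance

theorem exp_roundGap_mul_lintegral_roundWeight_le (G : MarkovGame S A B) {q : S → ℝ} {C : ℝ}
    (hq : IsNegativeSampling G.vol q C) {σ : JointPolicy S A B} (hσ : IsPolicy G.H σ) {h : ℕ}
    (hh : h < G.H) {w : DataPoint S A B → ℝ≥0∞} (hw : Measurable w)
    (hw1 : ∀ z, pointMean G q h w z ≤ 1) :
    ENNReal.ofReal (Real.exp (roundGap G q w h σ).toReal) *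
      ∫⁻ x, roundWeight w h x ∂(roundLaw G q σ) ≤ 1 := by
  have := isProbabilityMeasure_tildeDist G hσ hh.le
  have := isProbabilityMeasure_breveDist G hσ hh
  have hm := measurable_pointMean G hq.measurable hh hw
  have h1 := lintegral_add_lintegral_one_sub (G.tildeDist σ h) hm hw1
  have h2 := lintegral_add_lintegral_one_sub (G.breveDist σ h) hm hw1
  have hne := roundGap_ne_top G q w hσ hh
  cases h with
  | zero =>
    rw [lintegral_roundWeight_zero G hq hσ hw]
    simpa [roundGap] using ofReal_exp_mul_le_one h1
  | succ h =>
    rw [lintegral_roundWeight_succ G hq hσ hh hw]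
    simp only [roundGap, le_add_iff_nonneg_left, zero_le, if_true] at hne ⊢
    rw [ENNReal.add_ne_top] at hne
    rw [ENNReal.toReal_add hne.1 hne.2, Real.exp_add, ENNReal.ofReal_mul (Real.exp_nonneg _),
      mul_mul_mul_comm]
    exact mul_le_one' (ofReal_exp_mul_le_one h1) (ofReal_exp_mul_le_one h2)

theorem measurable_roundGap {Ω' : Type*} {mΩ' : MeasurableSpace Ω'} {C : ℝ}
    (hq : IsNegativeSampling G.vol q C) {σ : Ω' → JointPolicy S A B}
    (hσ : ∀ h < G.H, ∀ c : A × B, Measurable (fun x : Ω' × S => σ x.1 h x.2 c)) {h : ℕ}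
    (hh : h < G.H) {w : DataPoint S A B → ℝ≥0∞} (hw : Measurable w) :
    Measurable (fun ω => roundGap G q w h (σ ω)) := by
  have hm : Measurable (fun z => 1 - pointMean G q h w z) :=
    (measurable_pointMean G hq.measurable hh hw).const_sub _
  have h1 := measurable_lintegral_tildeDist G hσ hh.le
    (g := fun x : Ω' × (S × A × B) => 1 - pointMean G q h w x.2) (hm.comp measurable_snd)
  have h2 := measurable_lintegral_breveDist G hσ hh hm
  unfold roundGap
  split_ifs
  · exact h1.add h2
  · simpa using h1

namespace ContrastiveULCB

/-- Conditionally on the past, the draws of round `k + 1` follow `roundLaw`; this is the disintegrated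
form of the sampling assumption, for a weight `Y` that depends on the past. -/
theorem lintegral_mul_draw [IsProbabilityMeasure μ]
    (R : ContrastiveULCB μ G q Ψ Φ lam gam iota K) {C : ℝ}
    (hq : IsNegativeSampling G.vol q C) {k : ℕ} (hk : k < K) {Y : Ω → ℝ≥0∞}
    (hY : Measurable[R.𝓕 k] Y) {g : RoundDraw S A B G.H → ℝ≥0∞} (hg : Measurable g) :
    ∫⁻ ω, Y ω * g (R.X (k + 1) ω) ∂μ =
      ∫⁻ ω, Y ω * ∫⁻ x, g x ∂(roundLaw G q (R.σ k ω)) ∂μ := by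
  have hX : Measurable (R.X (k + 1)) :=
    (R.measurable_X (k + 1) (by omega) hk).mono (R.𝓕.le _) le_rfl
  have hκ' : Measurable[R.𝓕 k] (fun ω => roundLaw G q (R.σ k ω)) :=
    measurable_roundLaw G hq (R.measurable_σ k hk.le) (R.isPolicy hk.le)
  have hκ : Measurable (fun ω => roundLaw G q (R.σ k ω)) := hκ'.mono (R.𝓕.le _) le_rfl
  have hYm : Measurable Y := hY.mono (R.𝓕.le _) le_rfl
  have hgX : Measurable (fun ω => g (R.X (k + 1) ω)) := hg.comp hX
  have hgκ : Measurable (fun ω => ∫⁻ x, g x ∂(roundLaw G q (R.σ k ω))) :=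
    (Measure.measurable_lintegral hg).comp hκ
  have hset : ∀ E, MeasurableSet[R.𝓕 k] E → ∫⁻ ω in E, g (R.X (k + 1) ω) ∂μ =
      ∫⁻ ω in E, ∫⁻ x, g x ∂(roundLaw G q (R.σ k ω)) ∂μ := by
    intro E hE
    have e : (μ.restrict E).map (R.X (k + 1)) =
        (μ.restrict E).bind (fun ω => roundLaw G q (R.σ k ω)) := by
      ext U hU
      rw [Measure.map_apply hX hU, Measure.restrict_apply (hX hU),
        Measure.bind_apply hU hκ.aemeasurable, Set.inter_comm]
      exact R.cond_law k hk E hE U hU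
    rw [← lintegral_map hg hX, e, Measure.lintegral_bind hκ.aemeasurable hg.aemeasurable]
  have etrim : (μ.withDensity (fun ω => g (R.X (k + 1) ω))).trim (R.𝓕.le k) =
      (μ.withDensity (fun ω => ∫⁻ x, g x ∂(roundLaw G q (R.σ k ω)))).trim (R.𝓕.le k) := by
    refine @Measure.ext _ (R.𝓕 k) _ _ fun E hE => ?_
    rw [trim_measurableSet_eq _ hE, trim_measurableSet_eq _ hE,
      withDensity_apply _ (R.𝓕.le k _ hE), withDensity_apply _ (R.𝓕.le k _ hE), hset E hE]
  have h1 := lintegral_withDensity_eq_lintegral_mul μ hgX hYm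
  have h2 := lintegral_withDensity_eq_lintegral_mul μ hgκ hYm
  rw [← lintegral_trim (R.𝓕.le k) hY] at h1 h2
  rw [etrim, h2] at h1
  simp only [Pi.mul_apply] at h1
  simp only [mul_comm (Y _)]
  exact h1.symm

theorem measurable_exp_roundGap (R : ContrastiveULCB μ G q Ψ Φ lam gam iota K) {C : ℝ}
    (hq : IsNegativeSampling G.vol q C) {w : DataPoint S A B → ℝ≥0∞} (hw : Measurable w) {h : ℕ}
    (hh : h < G.H) {n : ℕ} (hn : n ≤ K) : Measurable[R.𝓕 n]
      (fun ω => ENNReal.ofReal (Real.exp (roundGap G q w h (R.σ n ω)).toReal)) :=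
  (Real.measurable_exp.comp
    (measurable_roundGap hq (R.measurable_σ n hn) hh hw).ennreal_toReal).ennreal_ofReal

theorem measurable_compensatedWeight (R : ContrastiveULCB μ G q Ψ Φ lam gam iota K) {C : ℝ}
    (hq : IsNegativeSampling G.vol q C) {w : DataPoint S A B → ℝ≥0∞} (hw : Measurable w) {h : ℕ}
    (hh : h < G.H) {n : ℕ} (hn : n ≤ K) : Measurable[R.𝓕 n] (R.compensatedWeight w h n) := by
  induction n with
  | zero =>
    have : R.compensatedWeight w h 0 = fun _ => 1 := by
      ext ω; simp [compensatedWeight, dataset]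
    rw [this]
    exact measurable_const
  | succ n ih =>
    have : R.compensatedWeight w h (n + 1) = fun ω => R.compensatedWeight w h n ω *
        ENNReal.ofReal (Real.exp (roundGap G q w h (R.σ n ω)).toReal) *
          roundWeight w h (R.X (n + 1) ω) := funext (R.compensatedWeight_succ w h n)
    rw [this]
    have hmono : R.𝓕 n ≤ R.𝓕 (n + 1) := R.𝓕.mono n.le_succ
    exact (((ih (by omega)).mono hmono le_rfl).mul
      ((R.measurable_exp_roundGap hq hw hh (by omega)).mono hmono le_rfl)).mul
      ((measurable_roundWeight hw h).comp (R.measurable_X (n + 1) (by omega) hn))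

/-- The compensated weight is a nonnegative supermartingale started at one. -/
theorem lintegral_compensatedWeight_le_one [IsProbabilityMeasure μ]
    (R : ContrastiveULCB μ G q Ψ Φ lam gam iota K) {C : ℝ}
    (hq : IsNegativeSampling G.vol q C) {w : DataPoint S A B → ℝ≥0∞} (hw : Measurable w) {h : ℕ}
    (hh : h < G.H) (hw1 : ∀ z, pointMean G q h w z ≤ 1) {n : ℕ} (hn : n ≤ K) :
    ∫⁻ ω, R.compensatedWeight w h n ω ∂μ ≤ 1 := by
  induction n with
  | zero => simp [compensatedWeight, dataset]
  | succ n ih =>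
    simp only [R.compensatedWeight_succ w h n]
    have hYm := (R.measurable_compensatedWeight hq hw hh (n := n) (by omega)).mul
      (R.measurable_exp_roundGap hq hw hh (n := n) (by omega))
    refine le_trans (le_of_eq
      (R.lintegral_mul_draw hq (k := n) (by omega) hYm (measurable_roundWeight hw h))) ?_
    refine le_trans (lintegral_mono fun ω => ?_) (ih (by omega))
    simp only [Pi.mul_apply]
    rw [mul_assoc]
    exact mul_le_of_le_one_right' (exp_roundGap_mul_lintegral_roundWeight_le G hq
      (R.isPolicy (by omega) ω) hh hw hw1)

end ContrastiveULCB

end Supermartingale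

/-! ### Weights built from density ratios -/

section RatioWeights

variable {S A B : Type*}

theorem length_dataset_ne_zero {H : ℕ} (X : ℕ → RoundDraw S A B H) (h : ℕ) {k : ℕ} (hk : 1 ≤ k) :
    (dataset X h k).length ≠ 0 := by
  obtain ⟨n, rfl⟩ := Nat.exists_eq_succ_of_ne_zero (by omega : k ≠ 0)
  simp [dataset, RoundDraw.points]

theorem sum_pointLoss_le_of_isContrastiveMin {d : ℕ} {Ψ : Finset (S → Feat d)}
    {Φ : Finset (S × A × B → Feat d)} {D : List (DataPoint S A B)} (hD : D.length ≠ 0)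
    {ψ ψ' : S → Feat d} {φ φ' : S × A × B → Feat d} (h : IsContrastiveMin Ψ Φ D ψ φ)
    (hψ' : ψ' ∈ Ψ) (hφ' : φ' ∈ Φ) :
    (D.map (fun x => pointLoss (inner ℝ (ψ x.2.1) (φ x.1)) x.2.2)).sum ≤
      (D.map (fun x => pointLoss (inner ℝ (ψ' x.2.1) (φ' x.1)) x.2.2)).sum := by
  have := h.2.2 ψ' hψ' φ' hφ'
  unfold contrastiveLoss at this
  have hn : (D.length : ℝ≥0∞) ≠ 0 := by exact_mod_cast hD
  have := mul_le_mul_left this (D.length : ℝ≥0∞)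
  rwa [ENNReal.div_mul_cancel hn (by simp), ENNReal.div_mul_cancel hn (by simp)] at this

/-- The square root of the likelihood ratio of a data point for the density ratios `f` and `g`. -/
noncomputable def ratioWeight (f g : S × A × B → S → ℝ) (x : DataPoint S A B) : ℝ≥0∞ :=
  sqrtRatio (f x.1 x.2.1) (g x.1 x.2.1) x.2.2

/-- The weight that is infinite on the points to which the density ratio `g` gives probability zero
and one on the others. -/
noncomputable def nullWeight (g : S × A × B → S → ℝ) (x : DataPoint S A B) : ℝ≥0∞ :=
  if labelProb (g x.1 x.2.1) x.2.2 = 0 then ⊤ else 1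

theorem labelProb_ne_zero_of_prod_nullWeight {g : S × A × B → S → ℝ} {D : List (DataPoint S A B)}
    (h : (D.map (nullWeight g)).prod ≠ ⊤) : ∀ x ∈ D, labelProb (g x.1 x.2.1) x.2.2 ≠ 0 := by
  have hone : ∀ D : List (DataPoint S A B), 1 ≤ (D.map (nullWeight g)).prod := by
    intro D
    refine List.one_le_prod fun x hx => ?_
    obtain ⟨y, -, rfl⟩ := List.mem_map.1 hx
    unfold nullWeight
    split_ifs <;> simp
  induction D with
  | nil => simp
  | cons a D ih =>
    simp only [List.map_cons, List.prod_cons] at h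
    have ha : nullWeight g a ≠ ⊤ := fun e => h (by
      rw [e, ENNReal.top_mul (zero_lt_one.trans_le (hone D)).ne'])
    have hD : (D.map (nullWeight g)).prod ≠ ⊤ := fun e => h (by
      have : nullWeight g a ≠ 0 := by unfold nullWeight; split_ifs <;> simp
      rw [e, ENNReal.mul_top this])
    intro x hx
    rcases List.mem_cons.1 hx with rfl | hx
    · intro e; exact ha (by simp [nullWeight, e])
    · exact ih hD x hx

variable [MeasurableSpace S] [MeasurableSpace A] [MeasurableSpace B]

theorem measurable_labelProb_point {f : S × A × B → S → ℝ}
    (hf : Measurable (fun x : (S × A × B) × S => f x.1 x.2)) :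
    Measurable (fun x : DataPoint S A B => labelProb (f x.1 x.2.1) x.2.2) := by
  have h : ∀ y, Measurable (fun x : (S × A × B) × S => labelProb (f x.1 x.2) y) :=
    fun y => (measurable_labelProb y).comp hf
  have h' : Measurable (fun x : ((S × A × B) × S) × Bool => labelProb (f x.1.1 x.1.2) x.2) :=
    measurable_from_prod_countable_left h
  exact h'.comp (by fun_prop : Measurable (fun x : DataPoint S A B => ((x.1, x.2.1), x.2.2)))

theorem measurable_ratioWeight {f g : S × A × B → S → ℝ}
    (hf : Measurable (fun x : (S × A × B) × S => f x.1 x.2))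
    (hg : Measurable (fun x : (S × A × B) × S => g x.1 x.2)) : Measurable (ratioWeight f g) :=
  ((measurable_labelProb_point hf).div (measurable_labelProb_point hg)).sqrt.ennreal_ofReal

theorem measurable_nullWeight {g : S × A × B → S → ℝ}
    (hg : Measurable (fun x : (S × A × B) × S => g x.1 x.2)) : Measurable (nullWeight g) :=
  Measurable.ite (measurable_labelProb_point hg (measurableSet_singleton 0)) measurable_const
    measurable_const

/-- The mean square root of the likelihood ratio is the Hellinger affinity. The points where `g`
vanishes do no harm: there the ratio is `0` by convention, and so is the density of the transition. -/
theorem pointMean_ratioWeight (G : MarkovGame S A B) {q : S → ℝ} {C : ℝ}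
    (hq : IsNegativeSampling G.vol q C) {h : ℕ} {f g : S × A × B → S → ℝ} {z : S × A × B}
    (hP : ∀ s', G.P h z s' = q s' * g z s') (hf : Measurable (f z)) (hg : Measurable (g z))
    (hg0 : ∀ s', 0 ≤ g z s') :
    pointMean G q h (ratioWeight f g) z = ∫⁻ s', ENNReal.ofReal (affDensity (f z s') (g z s'))
      ∂(G.vol.withDensity (fun s => ENNReal.ofReal (q s))) := by
  have hq0 : ∀ s, 0 ≤ q s := fun s => hq.C_pos.le.trans (hq.lower s)
  have hqm := hq.measurable
  have hl : ∀ y, Measurable (fun s' => labelProb (f z s') y / labelProb (g z s') y) := fun y =>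
    ((measurable_labelProb y).comp hf).div ((measurable_labelProb y).comp hg)
  have hlt := hl true
  have hlf := hl false
  have ha : Measurable (fun s' => affDensity (f z s') (g z s')) := by
    unfold affDensity; fun_prop
  rw [lintegral_withDensity_eq_lintegral_mul _ hqm.ennreal_ofReal ha.ennreal_ofReal, pointMean,
    ← lintegral_add_left, ← lintegral_const_mul]
  · refine lintegral_congr fun s' => ?_
    have h2 : (2 : ℝ≥0∞)⁻¹ = ENNReal.ofReal (1 / 2) := by
      rw [one_div, ENNReal.ofReal_inv_of_pos two_pos]; simp
    have h0 := hq0 s'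
    have h1 := hg0 s'
    simp only [ratioWeight, sqrtRatio, hP, Pi.mul_apply]
    rw [h2, ← ENNReal.ofReal_mul (by positivity), ← ENNReal.ofReal_mul (by positivity),
      ← ENNReal.ofReal_add (by positivity) (by positivity), ← ENNReal.ofReal_mul (by positivity),
      ← ENNReal.ofReal_mul (by positivity)]
    congr 1
    simp only [affDensity]
    ring
  · simp only [ratioWeight, sqrtRatio, hP]; fun_prop
  · simp only [ratioWeight, sqrtRatio, hP]; fun_prop

theorem lintegral_ratio_eq_one (G : MarkovGame S A B) {q : S → ℝ} {C : ℝ}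
    (hq : IsNegativeSampling G.vol q C) {h : ℕ} (hh : h < G.H) {g : S × A × B → S → ℝ}
    {z : S × A × B} (hP : ∀ s', G.P h z s' = q s' * g z s') (hg : Measurable (g z)) :
    ∫⁻ s', ENNReal.ofReal (g z s') ∂(G.vol.withDensity (fun s => ENNReal.ofReal (q s))) = 1 := by
  have hq0 : ∀ s, 0 ≤ q s := fun s => hq.C_pos.le.trans (hq.lower s)
  rw [lintegral_withDensity_eq_lintegral_mul _ hq.measurable.ennreal_ofReal hg.ennreal_ofReal,
    ← G.lintegral_P h hh z]
  refine lintegral_congr fun s' => ?_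
  simp only [Pi.mul_apply, hP, ENNReal.ofReal_mul (hq0 s')]

theorem pointMean_ratioWeight_le_one (G : MarkovGame S A B) {q : S → ℝ} {C : ℝ}
    (hq : IsNegativeSampling G.vol q C) {h : ℕ} (hh : h < G.H) {f g : S × A × B → S → ℝ}
    {z : S × A × B} (hP : ∀ s', G.P h z s' = q s' * g z s') (hf : Measurable (f z))
    (hg : Measurable (g z)) (hf0 : ∀ s', 0 ≤ f z s') (hg0 : ∀ s', 0 ≤ g z s') :
    pointMean G q h (ratioWeight f g) z ≤ 1 := by
  have := hq.isProbabilityMeasure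
  rw [pointMean_ratioWeight G hq hP hf hg hg0,
    ← lintegral_one_add_div_two hg0 (lintegral_ratio_eq_one G hq hh hP hg)]
  exact lintegral_mono fun s' => ENNReal.ofReal_le_ofReal (affDensity_le (hf0 s') (hg0 s'))

theorem pointMean_nullWeight (G : MarkovGame S A B) {q : S → ℝ} {C : ℝ}
    (hq : IsNegativeSampling G.vol q C) {h : ℕ} (hh : h < G.H) {g : S × A × B → S → ℝ}
    {z : S × A × B} (hP : ∀ s', G.P h z s' = q s' * g z s') (hg0 : ∀ s', 0 ≤ g z s') :
    pointMean G q h (nullWeight g) z = 1 := by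
  rw [← pointMean_one G hq hh z, pointMean, pointMean]
  congr 3
  · ext s'
    by_cases h0 : g z s' = 0
    · simp [hP, h0]
    · have : labelProb (g z s') true ≠ 0 := by
        have := lt_of_le_of_ne (hg0 s') (Ne.symm h0)
        simp only [labelProb, if_true]; positivity
      simp [nullWeight, this]
  · ext s'
    have : labelProb (g z s') false ≠ 0 := by
      have := hg0 s'
      simp only [labelProb, Bool.false_eq_true, if_false]; positivity
    simp [nullWeight, this]

/-- The squared `L¹` error of the estimated transition is at most `16 (1 + M)` times the Hellinger
gap, where `M` bounds the density ratios. -/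
theorem sq_lintegral_abs_sub_pHat_le {d : ℕ} (G : MarkovGame S A B) {q : S → ℝ} {C : ℝ}
    (hq : IsNegativeSampling G.vol q C) {h : ℕ} (hh : h < G.H) {ψ : S → Feat d}
    {φ : S × A × B → Feat d} {g : S × A × B → S → ℝ} {z : S × A × B}
    (hP : ∀ s', G.P h z s' = q s' * g z s') (hψ : Measurable ψ) (hg : Measurable (g z)) {M : ℝ}
    (hf0 : ∀ s', 0 ≤ (inner ℝ (ψ s') (φ z) : ℝ)) (hfM : ∀ s', (inner ℝ (ψ s') (φ z) : ℝ) ≤ M)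
    (hg0 : ∀ s', 0 ≤ g z s') (hgM : ∀ s', g z s' ≤ M) (hM : 0 ≤ M) :
    (∫⁻ s', ENNReal.ofReal |G.P h z s' - pHat G.vol q ψ φ z s'| ∂G.vol) ^ 2 ≤
      ENNReal.ofReal (16 * (1 + M)) *
        (1 - pointMean G q h (ratioWeight (fun z s' => inner ℝ (ψ s') (φ z)) g) z) := by
  have := hq.isProbabilityMeasure
  have hq0 : ∀ s, 0 ≤ q s := fun s => hq.C_pos.le.trans (hq.lower s)
  have hqm := hq.measurable
  have hf : Measurable (fun s' => (inner ℝ (ψ s') (φ z) : ℝ)) := by fun_prop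
  set ν := G.vol.withDensity (fun s => ENNReal.ofReal (q s)) with hν
  have eZ : ∫ s', q s' * inner ℝ (φ z) (ψ s') ∂G.vol = ∫ s', inner ℝ (ψ s') (φ z) ∂ν := by
    rw [hν, integral_withDensity_eq_integral_toReal_smul hqm.ennreal_ofReal (by simp)]
    simp [ENNReal.toReal_ofReal (hq0 _), real_inner_comm]
  have eL : ∫⁻ s', ENNReal.ofReal |G.P h z s' - pHat G.vol q ψ φ z s'| ∂G.vol =
      ∫⁻ s', ENNReal.ofReal |g z s' - inner ℝ (ψ s') (φ z) *
        (∫ s', inner ℝ (ψ s') (φ z) ∂ν)⁻¹| ∂ν := by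
    rw [hν, lintegral_withDensity_eq_lintegral_mul _ hqm.ennreal_ofReal (by fun_prop), ← hν]
    refine lintegral_congr fun s' => ?_
    rw [Pi.mul_apply, ← ENNReal.ofReal_mul (hq0 s'), pHat, psiHat, phiHat, eZ, hP,
      real_inner_smul_left, real_inner_smul_right]
    nth_rewrite 3 [← abs_of_nonneg (hq0 s')]
    rw [← abs_mul]
    congr 2
    ring
  have hg1 : ∫ s', g z s' ∂ν = 1 := by
    rw [integral_eq_lintegral_of_nonneg_ae (Filter.Eventually.of_forall hg0)
      hg.aestronglyMeasurable, lintegral_ratio_eq_one G hq hh hP hg, ENNReal.toReal_one]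
  rw [eL, pointMean_ratioWeight G hq hP hf hg hg0]
  exact sq_lintegral_abs_sub_normalized_le hf hg hf0 hfM hg0 hgM hg1 hM

/-- A bound of the true density ratio is at least one, because the ratio has mean one under `q`. -/
theorem one_le_of_ratio_le (G : MarkovGame S A B) {q : S → ℝ} {C : ℝ}
    (hq : IsNegativeSampling G.vol q C) {h : ℕ} (hh : h < G.H) {g : S × A × B → S → ℝ}
    {z : S × A × B} (hP : ∀ s', G.P h z s' = q s' * g z s') (hg : Measurable (g z)) {M : ℝ}
    (hgM : ∀ s', g z s' ≤ M) : 1 ≤ M := by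
  have := hq.isProbabilityMeasure
  rw [← ENNReal.one_le_ofReal, ← lintegral_ratio_eq_one G hq hh hP hg]
  refine (lintegral_mono fun s' => ENNReal.ofReal_le_ofReal (hgM s')).trans (le_of_eq ?_)
  simp

end RatioWeights

/-! ### The bound on the events where no likelihood ratio is large -/

section Errors

variable {S A B Ω : Type*} [MeasurableSpace S]
  [Fintype A] [Nonempty A] [MeasurableSpace A] [Fintype B] [Nonempty B] [MeasurableSpace B]
  [mΩ : MeasurableSpace Ω] {μ : Measure Ω} {d : ℕ} {G : MarkovGame S A B} {q : S → ℝ}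
  {Ψ : Finset (S → Feat d)} {Φ : Finset (S × A × B → Feat d)} {lam gam iota : ℕ → ℝ} {K : ℕ}

/-- If the compensated weight of the minimizer is below `T` then the gaps of the `k` rounds add up to at
most `log T`. -/
theorem ContrastiveULCB.sum_roundGap_le (R : ContrastiveULCB μ G q Ψ Φ lam gam iota K) {h k : ℕ}
    {ω : Ω} {w : DataPoint S A B → ℝ≥0∞}
    (hone : 1 ≤ ((dataset (fun τ => R.X τ ω) h k).map w).prod) {T : ℝ} (hT : 0 < T)
    (hlt : R.compensatedWeight w h k ω < ENNReal.ofReal T) :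
    ∑ i ∈ Finset.range k, (roundGap G q w h (R.σ i ω)).toReal ≤ Real.log T := by
  have h1 : ENNReal.ofReal (Real.exp
      (∑ i ∈ Finset.range k, (roundGap G q w h (R.σ i ω)).toReal)) < ENNReal.ofReal T :=
    lt_of_le_of_lt (le_mul_of_one_le_left' hone) hlt
  rw [ENNReal.ofReal_lt_ofReal_iff hT] at h1
  exact ((Real.lt_log_iff_exp_lt hT).2 h1).le

/-- The mean of a function over a mixture of `k` laws, when its means under these laws are bounded by
the gaps of the `k` rounds. -/
theorem lintegral_mixture_le {X : Type*} [MeasurableSpace X] {k : ℕ} {m : ℕ → Measure X}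
    {e : X → ℝ≥0∞} {u : ℕ → ℝ≥0∞} (hu : ∀ i < k, u i ≠ ⊤) {c L : ℝ} (hc : 0 ≤ c)
    (he : ∀ i < k, ∫⁻ x, e x ∂(m i) ≤ ENNReal.ofReal c * u i)
    (hL : ∑ i ∈ Finset.range k, (u i).toReal ≤ L) (hk : 1 ≤ k) :
    ∫⁻ x, e x ∂((k : ℝ≥0∞)⁻¹ • ∑ i ∈ Finset.range k, m i) ≤ ENNReal.ofReal (c * (L / k)) := by
  have hk' : (0 : ℝ) < k := by exact_mod_cast hk
  rw [lintegral_smul_measure, lintegral_finsetSum_measure, smul_eq_mul]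
  calc (k : ℝ≥0∞)⁻¹ * ∑ i ∈ Finset.range k, ∫⁻ x, e x ∂(m i)
      ≤ (k : ℝ≥0∞)⁻¹ * ∑ i ∈ Finset.range k, ENNReal.ofReal c * u i := by
        gcongr with i hi
        exact he i (Finset.mem_range.1 hi)
    _ = ENNReal.ofReal (c * ((∑ i ∈ Finset.range k, (u i).toReal) / k)) := by
        rw [← Finset.mul_sum, ENNReal.ofReal_mul hc, ENNReal.ofReal_div_of_pos hk',
          ENNReal.ofReal_sum_of_nonneg (fun i _ => ENNReal.toReal_nonneg),
          Finset.sum_congr rfl fun i hi => ENNReal.ofReal_toReal (hu i (Finset.mem_range.1 hi)),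
          ENNReal.ofReal_natCast, div_eq_mul_inv]
        ring
    _ ≤ ENNReal.ofReal (c * (L / k)) := by
        refine ENNReal.ofReal_le_ofReal ?_
        gcongr

end Errors

theorem lemma2 {S A B Ω : Type*} [MeasurableSpace S]
    [Fintype A] [Nonempty A] [MeasurableSpace A] [MeasurableSingletonClass A]
    [Fintype B] [Nonempty B] [MeasurableSpace B] [MeasurableSingletonClass B]
    [MeasurableSpace Ω] (μ : Measure Ω) [IsProbabilityMeasure μ] {d : ℕ}
    (G : MarkovGame S A B) (hlow : G.IsLowRank d)
    (C : ℝ) (q : S → ℝ) (hq : IsNegativeSampling G.vol q C)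
    (Ψ : Finset (S → Feat d)) (Φ : Finset (S × A × B → Feat d))
    (hF : IsFunctionClass C Ψ Φ) (hreal : IsRealizable G q Ψ Φ)
    (lam gam iota : ℕ → ℝ) (K : ℕ) (R : ContrastiveULCB μ G q Ψ Φ lam gam iota K)
    (k : ℕ) (hk : 1 ≤ k) (hkK : k ≤ K) (δ : ℝ) (hδ : 0 < δ) :
    ENNReal.ofReal (1 - 2 * δ) ≤ μ {ω |
      (∀ h < G.H, R.zeta k h ω ≤ ENNReal.ofReal (32 * (d : ℝ) / C ^ 2 *
        (Real.log (2 * (k : ℝ) * (G.H : ℝ) * ((Ψ.card : ℝ) * (Φ.card : ℝ)) / δ) / (k : ℝ)))) ∧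
      (∀ h, 1 ≤ h → h < G.H → R.xi k h ω ≤ ENNReal.ofReal (32 * (d : ℝ) / C ^ 2 *
        (Real.log (2 * (k : ℝ) * (G.H : ℝ) * ((Ψ.card : ℝ) * (Φ.card : ℝ)) / δ) / (k : ℝ))))} := by
  have hH : (0 : ℝ) < G.H := by exact_mod_cast G.H_pos
  have hCpos := hq.C_pos
  have hkpos : (1 : ℝ) ≤ k := by exact_mod_cast hk
  choose! ψs hψs φs hφs hfs using hreal
  have hΨ : (0 : ℝ) < Ψ.card := by exact_mod_cast Finset.card_pos.2 ⟨_, hψs 0 G.H_pos⟩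
  have hΦ : (0 : ℝ) < Φ.card := by exact_mod_cast Finset.card_pos.2 ⟨_, hφs 0 G.H_pos⟩
  set M : ℝ := √(d : ℝ) / C with hM
  -- the density ratio of a candidate
  set F : (S → Feat d) → (S × A × B → Feat d) → S × A × B → S → ℝ :=
    fun ψ φ z s' => inner ℝ (ψ s') (φ z) with hFdef
  have hM0 : 0 ≤ M := by positivity
  have hF0 : ∀ ψ ∈ Ψ, ∀ φ ∈ Φ, ∀ z s', 0 ≤ F ψ φ z s' := fun ψ hψ φ hφ z s' =>
    hF.nonneg ψ hψ φ hφ s' z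
  have hFM : ∀ ψ ∈ Ψ, ∀ φ ∈ Φ, ∀ z s', F ψ φ z s' ≤ M := fun ψ hψ φ hφ z s' =>
    calc F ψ φ z s' ≤ ‖ψ s'‖ * ‖φ z‖ := real_inner_le_norm _ _
      _ ≤ M * 1 := by
        gcongr
        · exact hF.norm_psi ψ hψ s'
        · exact hF.norm_phi φ hφ z
      _ = M := mul_one M
  have hFm : ∀ ψ ∈ Ψ, ∀ φ ∈ Φ, Measurable (fun x : (S × A × B) × S => F ψ φ x.1 x.2) := by
    intro ψ hψ φ hφ
    have := hF.measurable_psi ψ hψ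
    have := hF.measurable_phi φ hφ
    fun_prop
  have hFm' : ∀ ψ ∈ Ψ, ∀ φ ∈ Φ, ∀ z, Measurable (F ψ φ z) := fun ψ hψ φ hφ z =>
    (hFm ψ hψ φ hφ).comp measurable_prodMk_left
  have hP : ∀ h < G.H, ∀ z s', G.P h z s' = q s' * F (ψs h) (φs h) z s' := by
    intro h hh z s'
    have : q s' ≠ 0 := (hCpos.trans_le (hq.lower s')).ne'
    simp only [hFdef, hfs h hh]
    field_simp
  set w : ℕ → (S → Feat d) → (S × A × B → Feat d) → DataPoint S A B → ℝ≥0∞ :=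
    fun h ψ φ => ratioWeight (F ψ φ) (F (ψs h) (φs h)) with hw
  have hwm : ∀ h < G.H, ∀ ψ ∈ Ψ, ∀ φ ∈ Φ, Measurable (w h ψ φ) := fun h hh ψ hψ φ hφ =>
    measurable_ratioWeight (hFm ψ hψ φ hφ) (hFm _ (hψs h hh) _ (hφs h hh))
  have hM1 : 1 ≤ M :=
    one_le_of_ratio_le G hq G.H_pos (z := (G.s₁, Classical.arbitrary A, Classical.arbitrary B))
      (hP 0 G.H_pos _) (hFm' _ (hψs 0 G.H_pos) _ (hφs 0 G.H_pos) _)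
      (hFM _ (hψs 0 G.H_pos) _ (hφs 0 G.H_pos) _)
  -- the threshold of a union bound over the steps and the candidates, at level `δ`
  set T : ℝ := G.H * (Ψ.card * Φ.card) / δ with hT
  have hTpos : 0 < T := by positivity
  -- outside of `bad` no candidate has a large likelihood ratio
  set bad : Set Ω := ⋃ h ∈ Finset.range G.H, ⋃ ψ ∈ Ψ, ⋃ φ ∈ Φ,
    {ω | ENNReal.ofReal T ≤ R.compensatedWeight (w h ψ φ) h k ω} with hbad
  have hbad_le : μ bad ≤ ENNReal.ofReal δ := by
    have h1 : ∀ h ∈ Finset.range G.H, ∀ ψ ∈ Ψ, ∀ φ ∈ Φ,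
        μ {ω | ENNReal.ofReal T ≤ R.compensatedWeight (w h ψ φ) h k ω} ≤ ENNReal.ofReal T⁻¹ := by
      intro h hh ψ hψ φ hφ
      have hh := Finset.mem_range.1 hh
      refine (meas_ge_le_lintegral_div ((R.measurable_compensatedWeight hq (hwm h hh ψ hψ φ hφ) hh
        hkK).mono (R.𝓕.le k) le_rfl).aemeasurable (by simpa using hTpos)
        ENNReal.ofReal_ne_top).trans ?_
      rw [ENNReal.ofReal_inv_of_pos hTpos, ← one_div]
      gcongr
      exact R.lintegral_compensatedWeight_le_one hq (hwm h hh ψ hψ φ hφ) hh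
        (fun z => pointMean_ratioWeight_le_one G hq hh (hP h hh z) (hFm' ψ hψ φ hφ z)
          (hFm' _ (hψs h hh) _ (hφs h hh) z) (hF0 ψ hψ φ hφ z) (hF0 _ (hψs h hh) _ (hφs h hh) z))
        hkK
    calc μ bad ≤ ∑ h ∈ Finset.range G.H, ∑ ψ ∈ Ψ, ∑ φ ∈ Φ,
          μ {ω | ENNReal.ofReal T ≤ R.compensatedWeight (w h ψ φ) h k ω} := by
          refine (measure_biUnion_finset_le _ _).trans (Finset.sum_le_sum fun h _ => ?_)
          refine (measure_biUnion_finset_le _ _).trans (Finset.sum_le_sum fun ψ _ => ?_)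
          exact measure_biUnion_finset_le _ _
      _ ≤ ∑ h ∈ Finset.range G.H, ∑ ψ ∈ Ψ, ∑ φ ∈ Φ, ENNReal.ofReal T⁻¹ :=
          Finset.sum_le_sum fun h hh => Finset.sum_le_sum fun ψ hψ => Finset.sum_le_sum fun φ hφ =>
            h1 h hh ψ hψ φ hφ
      _ = ENNReal.ofReal (G.H * (Ψ.card * (Φ.card * T⁻¹))) := by
          simp only [Finset.sum_const, Finset.card_range, nsmul_eq_mul]
          rw [ENNReal.ofReal_mul (by positivity), ENNReal.ofReal_mul (by positivity),
            ENNReal.ofReal_mul (by positivity)]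
          simp
      _ = ENNReal.ofReal δ := by
          congr 1
          rw [hT]
          field_simp
  -- almost surely the loss of the truth is finite, as a weight with mean one is
  have hnull : ∀ᵐ ω ∂μ, ∀ h ∈ Finset.range G.H, ∀ x ∈ dataset (fun τ => R.X τ ω) h k,
      labelProb (F (ψs h) (φs h) x.1 x.2.1) x.2.2 ≠ 0 := by
    rw [Filter.eventually_all_finset]
    intro h hh
    have hh := Finset.mem_range.1 hh
    have hm := measurable_nullWeight (hFm _ (hψs h hh) _ (hφs h hh))
    have h1 := R.lintegral_compensatedWeight_le_one hq hm hh
      (fun z => (pointMean_nullWeight G hq hh (hP h hh z)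
        (hF0 _ (hψs h hh) _ (hφs h hh) z)).le) hkK
    filter_upwards [ae_lt_top ((R.measurable_compensatedWeight hq hm hh hkK).mono (R.𝓕.le k) le_rfl)
      (ne_top_of_le_ne_top ENNReal.one_ne_top h1)] with ω hω
    refine labelProb_ne_zero_of_prod_nullWeight fun e => hω.ne ?_
    rw [ContrastiveULCB.compensatedWeight, e, ENNReal.top_mul]
    simpa using Real.exp_pos _
  set c : ℝ := 16 * (1 + M) with hc
  -- off these events the minimizer has likelihood ratio at least one, so its gaps are small
  have hgood : ∀ ω, ω ∉ bad → (∀ h ∈ Finset.range G.H, ∀ x ∈ dataset (fun τ => R.X τ ω) h k,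
      labelProb (F (ψs h) (φs h) x.1 x.2.1) x.2.2 ≠ 0) → ∀ h < G.H,
      R.zeta k h ω ≤ ENNReal.ofReal (c * (Real.log T / k)) ∧
      (1 ≤ h → R.xi k h ω ≤ ENNReal.ofReal (c * (Real.log T / k))) ∧ 0 ≤ Real.log T := by
    intro ω hω hpos h hh
    have hmin := R.argmin k hk hkK h hh ω
    set ψ := R.ψt k h ω with hψ_def
    set φ := R.φt k h ω with hφ_def
    have hψ : ψ ∈ Ψ := hmin.1
    have hφ : φ ∈ Φ := hmin.2.1
    have hlt : R.compensatedWeight (w h ψ φ) h k ω < ENNReal.ofReal T := by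
      by_contra! hge
      exact hω (Set.mem_biUnion (Finset.mem_range.2 hh)
        (Set.mem_biUnion hψ (Set.mem_biUnion hφ hge)))
    have hone : 1 ≤ ((dataset (fun τ => R.X τ ω) h k).map (w h ψ φ)).prod :=
      one_le_prod_sqrtRatio _ (fun x _ => hF0 ψ hψ φ hφ x.1 x.2.1)
        (fun x _ => hF0 _ (hψs h hh) _ (hφs h hh) x.1 x.2.1) (hpos h (Finset.mem_range.2 hh))
        (sum_pointLoss_le_of_isContrastiveMin (length_dataset_ne_zero _ h hk) hmin (hψs h hh)
          (hφs h hh))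
    have hsum := R.sum_roundGap_le hone hTpos hlt
    have herr : ∀ z, R.l1Error k h ω z ^ 2 ≤
        ENNReal.ofReal c * (1 - pointMean G q h (w h ψ φ) z) := fun z =>
      sq_lintegral_abs_sub_pHat_le G hq hh (hP h hh z) (hF.measurable_psi ψ hψ)
        (hFm' _ (hψs h hh) _ (hφs h hh) z) (hF0 ψ hψ φ hφ z) (hFM ψ hψ φ hφ z)
        (hF0 _ (hψs h hh) _ (hφs h hh) z) (hFM _ (hψs h hh) _ (hφs h hh) z) hM0
    have hint : ∀ m : Measure (S × A × B), ∫⁻ z, R.l1Error k h ω z ^ 2 ∂m ≤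
        ENNReal.ofReal c * ∫⁻ z, (1 - pointMean G q h (w h ψ φ) z) ∂m := fun m => by
      rw [← lintegral_const_mul' _ _ ENNReal.ofReal_ne_top]
      exact lintegral_mono herr
    have hu : ∀ i < k, roundGap G q (w h ψ φ) h (R.σ i ω) ≠ ⊤ := fun i hi =>
      roundGap_ne_top G q _ (R.isPolicy (by omega) ω) hh
    refine ⟨lintegral_mixture_le hu (by positivity) (fun i hi => (hint _).trans ?_) hsum hk,
      fun h1 => lintegral_mixture_le hu (by positivity) (fun i hi => (hint _).trans ?_) hsum hk,
      (Finset.sum_nonneg fun i _ => ENNReal.toReal_nonneg).trans hsum⟩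
    · unfold roundGap
      gcongr
      exact le_self_add
    · simp only [roundGap, h1, if_true]
      gcongr
      exact le_add_self
  have hconst : 0 ≤ Real.log T → c * (Real.log T / k) ≤ 32 * (d : ℝ) / C ^ 2 *
      (Real.log (2 * (k : ℝ) * (G.H : ℝ) * ((Ψ.card : ℝ) * (Φ.card : ℝ)) / δ) / (k : ℝ)) := by
    intro hlog
    have hMsq : 32 * (d : ℝ) / C ^ 2 = 32 * M ^ 2 := by
      rw [hM, div_pow, Real.sq_sqrt (by positivity)]
      ring
    rw [hMsq]
    -- as `1 ≤ M`, the constant `16 * (1 + M)` is at most `32 * M ^ 2 = 32 * d / C ^ 2`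
    have h1 : c ≤ 32 * M ^ 2 := by nlinarith
    have h2 : Real.log T ≤
        Real.log (2 * (k : ℝ) * (G.H : ℝ) * ((Ψ.card : ℝ) * (Φ.card : ℝ)) / δ) := by
      refine Real.log_le_log hTpos ?_
      have : 2 * (k : ℝ) * (G.H : ℝ) * ((Ψ.card : ℝ) * (Φ.card : ℝ)) / δ = (2 * k) * T := by
        rw [hT]; ring
      rw [this]
      nlinarith
    gcongr
  set good : Set Ω := {ω | (∀ h < G.H, R.zeta k h ω ≤ ENNReal.ofReal (32 * (d : ℝ) / C ^ 2 *
        (Real.log (2 * (k : ℝ) * (G.H : ℝ) * ((Ψ.card : ℝ) * (Φ.card : ℝ)) / δ) / (k : ℝ)))) ∧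
      (∀ h, 1 ≤ h → h < G.H → R.xi k h ω ≤ ENNReal.ofReal (32 * (d : ℝ) / C ^ 2 *
        (Real.log (2 * (k : ℝ) * (G.H : ℝ) * ((Ψ.card : ℝ) * (Φ.card : ℝ)) / δ) / (k : ℝ))))}
    with hgood_def
  have hcompl : μ goodᶜ ≤ μ bad := by
    refine measure_mono_ae ?_
    filter_upwards [hnull] with ω hω hng
    by_contra hb
    refine hng ⟨fun h hh => ?_, fun h h1 hh => ?_⟩
    · obtain ⟨a, -, b⟩ := hgood ω hb hω h hh
      exact a.trans (ENNReal.ofReal_le_ofReal (hconst b))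
    · obtain ⟨-, a, b⟩ := hgood ω hb hω h hh
      exact (a h1).trans (ENNReal.ofReal_le_ofReal (hconst b))
  have htot : 1 ≤ μ good + ENNReal.ofReal δ := by
    calc 1 = μ (good ∪ goodᶜ) := by simp
      _ ≤ μ good + μ goodᶜ := measure_union_le _ _
      _ ≤ μ good + ENNReal.ofReal δ := by gcongr; exact hcompl.trans hbad_le
  calc ENNReal.ofReal (1 - 2 * δ) ≤ ENNReal.ofReal (1 - δ) :=
        ENNReal.ofReal_le_ofReal (by linarith)
    _ = 1 - ENNReal.ofReal δ := by rw [ENNReal.ofReal_sub _ hδ.le, ENNReal.ofReal_one]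
    _ ≤ μ good := tsub_le_iff_right.2 htot
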